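/- Work over $\mathbb C$. For $n\ge 0$ let $Y_n=Y(\mathfrak{gl}_n)$ be the Yangian: the unital associative algebra with generators $T_{i,j}^{(r)}$ ($1\le i,j\le n$, $r\ge 1$) and the relations $$(u-v)\,[T_{i,j}(u),T_{h,k}(v)]=T_{h,j}(u)\,T_{i,k}(v)-T_{h,j}(v)\,T_{i,k}(u)\qquad(1\le h,i,j,k\le n),$$ where $T_{i,j}(u)=\sum_{r\ge 0}T_{i,j}^{(r)}u^{-r}$ and $T_{i,j}^{(0)}=\delta_{i,j}$. Put $T(u)=(T_{i,j}(u))_{1\le i,j\le n}$. For $k\le n$ let $Y_k\to Y_n$ be the standard embedding $T_{i,j}^{(r)}\mapsto T_{i,j}^{(r)}$. Let $\omega_n\colon Y_n\to Y_n$ be the automorphism given by $T(u)\mapsto T(-u)^{-1}$, let $\varphi_m\colon Y_n\to Y_{m+n}$ be the homomorphism $T_{i,j}^{(r)}\mapsto T_{m+i,m+j}^{(r)}$, and set $\psi_m=\omega_{m+n}\circ\varphi_m\circ\omega_n\colon Y_n\to Y_{m+n}$. Let $\nu=(\nu_1,\dots,\nu_m)$ be a tuple of non-negative integers with sum $n$.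 The standard Levi subalgebra of $Y_n$ is $$Y_\nu=Y_{\nu_1}\,\psi_{\nu_1}(Y_{\nu_2})\,\psi_{\nu_1+\nu_2}(Y_{\nu_3})\cdots\psi_{\nu_1+\cdots+\nu_{m-1}}(Y_{\nu_m}),$$ the subalgebra generated by the subalgebras $\psi_{\nu_1+\cdots+\nu_{a-1}}(Y_{\nu_a})\subseteq Y_{\nu_1+\cdots+\nu_a}$, $1\le a\le m$, all regarded inside $Y_n$ through the standard embeddings. Then the centralizer of $Y_\nu$ in $Y_n$ is equal to the center $Z(Y_\nu)$ of the algebra $Y_\nu$. -/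

import Mathlib

noncomputable section

/-- The generators `T_{i,j}^{(r)}`, `r ≥ 0`, inside the free algebra. The free generator indexed by
`(i, j, r)` is `T_{i,j}^{(r+1)}`, and `T_{i,j}^{(0)}` is the Kronecker delta. -/
def Yangian.freeT (n : ℕ) (i j : Fin n) : ℕ → FreeAlgebra ℂ (Fin n × Fin n × ℕ)
  | 0 => if i = j then 1 else 0
  | r + 1 => FreeAlgebra.ι ℂ (i, j, r)

/-- The RTT relations: the coefficients of `u^{-r} v^{-s}` (`r, s ≥ 0`) in
`(u - v) [T_{i,j}(u), T_{h,k}(v)] = T_{h,j}(u) T_{i,k}(v) - T_{h,j}(v) T_{i,k}(u)`.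
(The coefficients of `u v^{-s}` and `u^{-r} v` give nothing, as `T_{i,j}^{(0)}` is a scalar.) -/
inductive Yangian.Rel (n : ℕ) :
    FreeAlgebra ℂ (Fin n × Fin n × ℕ) → FreeAlgebra ℂ (Fin n × Fin n × ℕ) → Prop
  | rtt (i j h k : Fin n) (r s : ℕ) : Yangian.Rel n
      ((Yangian.freeT n i j (r + 1) * Yangian.freeT n h k s
          - Yangian.freeT n h k s * Yangian.freeT n i j (r + 1))
        - (Yangian.freeT n i j r * Yangian.freeT n h k (s + 1)
          - Yangian.freeT n h k (s + 1) * Yangian.freeT n i j r))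
      (Yangian.freeT n h j r * Yangian.freeT n i k s
        - Yangian.freeT n h j s * Yangian.freeT n i k r)

/-- The Yangian `Y_n = Y(𝔤𝔩_n)` over `ℂ`. -/
abbrev Yangian (n : ℕ) : Type := RingQuot (Yangian.Rel n)

namespace Yangian

/-- The quotient map from the free algebra. -/
def mk (n : ℕ) : FreeAlgebra ℂ (Fin n × Fin n × ℕ) →ₐ[ℂ] Yangian n :=
  RingQuot.mkAlgHom ℂ (Yangian.Rel n)

/-- The element `T_{i,j}^{(r)}` of `Y_n`, for `r ≥ 0`. -/
def T (n : ℕ) (i j : Fin n) (r : ℕ) : Yangian n := mk n (freeT n i j r)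

theorem T_zero (n : ℕ) (i j : Fin n) : T n i j 0 = if i = j then 1 else 0 := by
  unfold T freeT
  split_ifs <;> simp

theorem T_rel (n : ℕ) (i j h k : Fin n) (r s : ℕ) :
    (T n i j (r + 1) * T n h k s - T n h k s * T n i j (r + 1))
      - (T n i j r * T n h k (s + 1) - T n h k (s + 1) * T n i j r)
    = T n h j r * T n i k s - T n h j s * T n i k r := by
  have := RingQuot.mkAlgHom_rel ℂ (Rel.rtt i j h k r s)
  simpa only [T, mk, map_sub, map_mul] using this

/-- The homomorphism out of `Y_n` determined by a family of elements `S i j r` (`r ≥ 0`) satisfying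
the defining relations. It sends `T_{i,j}^{(r)}` to `S i j r`. -/
def lift {n : ℕ} {A : Type*} [Ring A] [Algebra ℂ A] (S : Fin n → Fin n → ℕ → A)
    (h0 : ∀ i j, S i j 0 = if i = j then 1 else 0)
    (hS : ∀ i j h k r s,
      (S i j (r + 1) * S h k s - S h k s * S i j (r + 1))
        - (S i j r * S h k (s + 1) - S h k (s + 1) * S i j r)
      = S h j r * S i k s - S h j s * S i k r) : Yangian n →ₐ[ℂ] A :=
  RingQuot.liftAlgHom ℂ
    ⟨FreeAlgebra.lift ℂ (fun x : Fin n × Fin n × ℕ => S x.1 x.2.1 (x.2.2 + 1)), by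
      have key : ∀ i j r, FreeAlgebra.lift ℂ
          (fun x : Fin n × Fin n × ℕ => S x.1 x.2.1 (x.2.2 + 1)) (freeT n i j r) = S i j r := by
        intro i j r
        cases r with
        | zero =>
          rw [h0]
          unfold freeT
          split_ifs <;> simp
        | succ r => simp [freeT]
      rintro x y ⟨i, j, h, k, r, s⟩
      simp only [map_sub, map_mul, key]
      exact hS i j h k r s⟩

theorem lift_T {n : ℕ} {A : Type*} [Ring A] [Algebra ℂ A] (S : Fin n → Fin n → ℕ → A)
    (h0 : ∀ i j, S i j 0 = if i = j then 1 else 0)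
    (hS : ∀ i j h k r s,
      (S i j (r + 1) * S h k s - S h k s * S i j (r + 1))
        - (S i j r * S h k (s + 1) - S h k (s + 1) * S i j r)
      = S h j r * S i k s - S h j s * S i k r) (i j : Fin n) (r : ℕ) :
    lift S h0 hS (T n i j r) = S i j r := by
  unfold lift T mk
  rw [RingQuot.liftAlgHom_mkAlgHom_apply]
  cases r with
  | zero =>
    rw [h0]
    unfold freeT
    split_ifs <;> simp
  | succ r => simp [freeT]

/-- The homomorphism `Y_k → Y_n` sending `T_{i,j}^{(r)}` to `T_{f(i),f(j)}^{(r)}`, for an injection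
`f` of the index sets. -/
def relabel {k n : ℕ} (f : Fin k ↪ Fin n) : Yangian k →ₐ[ℂ] Yangian n :=
  lift (fun i j r => T n (f i) (f j) r) (fun i j => by simp [T_zero])
    (fun i j h k r s => T_rel n (f i) (f j) (f h) (f k) r s)

theorem relabel_T {k n : ℕ} (f : Fin k ↪ Fin n) (i j : Fin k) (r : ℕ) :
    relabel f (T k i j r) = T n (f i) (f j) r := lift_T _ _ _ _ _ _

/-- The standard embedding `Y_k → Y_n` (`k ≤ n`), sending `T_{i,j}^{(r)}` to the element with the
same name. -/
def standardEmbedding {k n : ℕ} (h : k ≤ n) : Yangian k →ₐ[ℂ] Yangian n :=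
  relabel (Fin.castLEEmb h)

/-- `φ_m : Y_n → Y_{m+n}`, sending `T_{i,j}^{(r)}` to `T_{m+i,m+j}^{(r)}`. -/
def phi (m n : ℕ) : Yangian n →ₐ[ℂ] Yangian (m + n) :=
  relabel (Fin.natAddEmb m)

/-- The matrix power series `T(-u)`, in the variable `X = u^{-1}`: an element of
`M_n(Y_n)⟦u^{-1}⟧ = M_n ⊗ Y_n⟦u^{-1}⟧`. -/
def Tneg (n : ℕ) : PowerSeries (Matrix (Fin n) (Fin n) (Yangian n)) :=
  PowerSeries.mk fun r => Matrix.of fun i j => (-1 : ℂ) ^ r • T n i j r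

/-- The matrix power series `T(-u)⁻¹`; see `Tneg_mul_TnegInv` and `TnegInv_mul_Tneg`. -/
def TnegInv (n : ℕ) : PowerSeries (Matrix (Fin n) (Fin n) (Yangian n)) :=
  PowerSeries.invOfUnit (Tneg n) 1

theorem constantCoeff_Tneg (n : ℕ) : PowerSeries.constantCoeff (Tneg n) = 1 := by
  rw [← PowerSeries.coeff_zero_eq_constantCoeff_apply]
  ext i j
  simp [Tneg, T_zero, Matrix.one_apply]

theorem Tneg_mul_TnegInv (n : ℕ) : Tneg n * TnegInv n = 1 :=
  PowerSeries.mul_invOfUnit _ _ (by simpa using constantCoeff_Tneg n)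

theorem TnegInv_mul_Tneg (n : ℕ) : TnegInv n * Tneg n = 1 :=
  PowerSeries.invOfUnit_mul _ _ (by simpa using constantCoeff_Tneg n)

theorem coeff_zero_TnegInv (n : ℕ) : PowerSeries.coeff 0 (TnegInv n) = 1 := by
  rw [PowerSeries.coeff_zero_eq_constantCoeff_apply, TnegInv, PowerSeries.constantCoeff_invOfUnit]
  simp

/-- If `a(u)`, `b(v)` satisfy `R(u-v) a(u) b(v) = b(v) a(u) R(u-v)` with `R(u) = u + P`, then their
inverses satisfy `R(u-v) b'(v) a'(u) = a'(u) b'(v) R(u-v)`. -/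
theorem rtt_inverse {M : Type*} [Ring M] (P : M) (a b a' b' : PowerSeries M)
    (ha : a * a' = 1) (ha' : a' * a = 1) (hb : b * b' = 1) (hb' : b' * b = 1)
    (a0 : PowerSeries.constantCoeff a = 1) (b0 : PowerSeries.constantCoeff b = 1)
    (hab : ∀ r s,
      (PowerSeries.coeff (r + 1) a * PowerSeries.coeff s b
          - PowerSeries.coeff s b * PowerSeries.coeff (r + 1) a)
        - (PowerSeries.coeff r a * PowerSeries.coeff (s + 1) b
          - PowerSeries.coeff (s + 1) b * PowerSeries.coeff r a)
      = PowerSeries.coeff s b * PowerSeries.coeff r a * P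
        - P * (PowerSeries.coeff r a * PowerSeries.coeff s b)) (r s : ℕ) :
    (PowerSeries.coeff (r + 1) a' * PowerSeries.coeff s b'
        - PowerSeries.coeff s b' * PowerSeries.coeff (r + 1) a')
      - (PowerSeries.coeff r a' * PowerSeries.coeff (s + 1) b'
        - PowerSeries.coeff (s + 1) b' * PowerSeries.coeff r a')
    = P * (PowerSeries.coeff s b' * PowerSeries.coeff r a')
      - PowerSeries.coeff r a' * PowerSeries.coeff s b' * P := by
  let α : PowerSeries M →+* PowerSeries (PowerSeries M) := PowerSeries.C
  let β : PowerSeries M →+* PowerSeries (PowerSeries M) := PowerSeries.map PowerSeries.C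
  let y : PowerSeries (PowerSeries M) := PowerSeries.X
  let x : PowerSeries (PowerSeries M) := PowerSeries.C PowerSeries.X
  let p : PowerSeries (PowerSeries M) := PowerSeries.C (PowerSeries.C P)
  have hy : ∀ q, q * y = y * q := fun q => (PowerSeries.commute_X q).eq
  have hx : ∀ q, q * x = x * q := by
    intro q
    ext1 s
    simp only [x, PowerSeries.coeff_mul_C, PowerSeries.coeff_C_mul]
    exact (PowerSeries.commute_X _).eq
  have h1 : (y - x + y * x * p) * (α a * β b) = (β b * α a) * (y - x + y * x * p) := by
    have e1 : (y - x + y * x * p) * (α a * β b)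
        = y * (α a * β b) - x * (α a * β b) + y * (x * (p * (α a * β b))) := by noncomm_ring
    have e2 : (β b * α a) * (y - x + y * x * p)
        = y * (β b * α a) - x * (β b * α a) + y * (x * (β b * α a * p)) := by
      rw [mul_add, mul_sub, hy, hx, ← mul_assoc _ _ p, ← mul_assoc _ y x, hy, mul_assoc y _ x, hx]
      simp only [mul_assoc]
    have b0' : PowerSeries.constantCoeff (PowerSeries.map (PowerSeries.C (R := M)) b) = 1 := by
      rw [← PowerSeries.coeff_zero_eq_constantCoeff_apply, PowerSeries.coeff_map,
        PowerSeries.coeff_zero_eq_constantCoeff_apply, b0, map_one]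
    rw [e1, e2]
    ext s r
    rcases s with _ | s <;> rcases r with _ | r
    · simp [y, x, p, α, β, mul_assoc]
    · simp [y, x, p, α, β, PowerSeries.coeff_succ_X_mul, b0']
    · simp [y, x, p, α, β, PowerSeries.coeff_succ_X_mul, PowerSeries.coeff_C_mul,
        PowerSeries.coeff_mul_C, a0]
    · have := hab r s
      simp only [y, x, p, α, β, map_add, map_sub, PowerSeries.coeff_succ_X_mul,
        PowerSeries.coeff_C_mul, PowerSeries.coeff_mul_C, PowerSeries.coeff_map]
      grind
  have h2 : (α a' * β b') * (y - x + y * x * p) = (y - x + y * x * p) * (β b' * α a') := by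
    have ea : α a * α a' = 1 := by rw [← map_mul, ha, map_one]
    have ea' : α a' * α a = 1 := by rw [← map_mul, ha', map_one]
    have eb : β b * β b' = 1 := by rw [← map_mul, hb, map_one]
    have eb' : β b' * β b = 1 := by rw [← map_mul, hb', map_one]
    generalize y - x + y * x * p = R at h1
    calc (α a' * β b') * R = (α a' * β b') * R * (α a * (β b * β b') * α a') := by simp [eb, ea]
      _ = (α a' * β b') * (R * (α a * β b)) * (β b' * α a') := by simp only [mul_assoc]
      _ = (α a' * (β b' * β b) * α a) * R * (β b' * α a') := by rw [h1]; simp only [mul_assoc]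
      _ = _ := by simp [eb', ea']
  have h3 : y * (α a' * β b') - x * (α a' * β b') + y * (x * (α a' * β b' * p))
      = y * (β b' * α a') - x * (β b' * α a') + y * (x * (p * (β b' * α a'))) := by
    have e1 : (y - x + y * x * p) * (β b' * α a')
        = y * (β b' * α a') - x * (β b' * α a') + y * (x * (p * (β b' * α a'))) := by noncomm_ring
    have e2 : (α a' * β b') * (y - x + y * x * p)
        = y * (α a' * β b') - x * (α a' * β b') + y * (x * (α a' * β b' * p)) := by
      rw [mul_add, mul_sub, hy, hx, ← mul_assoc _ _ p, ← mul_assoc _ y x, hy, mul_assoc y _ x, hx]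
      simp only [mul_assoc]
    rw [← e1, ← e2, h2]
  have h4 := congrArg (fun q => PowerSeries.coeff (r + 1) (PowerSeries.coeff (s + 1) q)) h3
  simp only [y, x, p, α, β, map_add, map_sub, PowerSeries.coeff_succ_X_mul,
    PowerSeries.coeff_C_mul, PowerSeries.coeff_mul_C, PowerSeries.coeff_map] at h4
  grind

/-- The embedding `x ↦ x ⊗ 1` of `M_n(A)` in `M_n ⊗ M_n ⊗ A`. -/
def leg1 (n : ℕ) (A : Type*) [Ring A] :
    Matrix (Fin n) (Fin n) A →+* Matrix (Fin n × Fin n) (Fin n × Fin n) A where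
  toFun x := Matrix.of fun p q => if p.2 = q.2 then x p.1 q.1 else 0
  map_one' := by
    ext p q
    simp only [Matrix.of_apply, Matrix.one_apply, Prod.ext_iff]
    split_ifs <;> simp_all
  map_zero' := by
    ext p q
    simp
  map_add' x y := by
    ext p q
    simp only [Matrix.of_apply, Matrix.add_apply]
    split_ifs <;> simp
  map_mul' x y := by
    ext p q
    by_cases hpq : p.2 = q.2 <;> simp [Matrix.mul_apply, Fintype.sum_prod_type, hpq]

/-- The embedding `x ↦ 1 ⊗ x` of `M_n(A)` in `M_n ⊗ M_n ⊗ A`. -/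
def leg2 (n : ℕ) (A : Type*) [Ring A] :
    Matrix (Fin n) (Fin n) A →+* Matrix (Fin n × Fin n) (Fin n × Fin n) A where
  toFun x := Matrix.of fun p q => if p.1 = q.1 then x p.2 q.2 else 0
  map_one' := by
    ext p q
    simp only [Matrix.of_apply, Matrix.one_apply, Prod.ext_iff]
    split_ifs <;> simp_all
  map_zero' := by
    ext p q
    simp
  map_add' x y := by
    ext p q
    simp only [Matrix.of_apply, Matrix.add_apply]
    split_ifs <;> simp
  map_mul' x y := by
    ext p q
    by_cases hpq : p.1 = q.1 <;> simp [Matrix.mul_apply, Fintype.sum_prod_type_right, hpq]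

/-- The permutation matrix `P = ∑ e_{i,j} ⊗ e_{j,i}`. -/
def flipMatrix (n : ℕ) (A : Type*) [Ring A] : Matrix (Fin n × Fin n) (Fin n × Fin n) A :=
  Matrix.of fun p q => if q = p.swap then 1 else 0

theorem leg1_mul_leg2 {n : ℕ} {A : Type*} [Ring A] (x y : Matrix (Fin n) (Fin n) A)
    (p q : Fin n × Fin n) : (leg1 n A x * leg2 n A y) p q = x p.1 q.1 * y p.2 q.2 := by
  simp [leg1, leg2, Matrix.mul_apply, Fintype.sum_prod_type]

theorem leg2_mul_leg1 {n : ℕ} {A : Type*} [Ring A] (x y : Matrix (Fin n) (Fin n) A)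
    (p q : Fin n × Fin n) : (leg2 n A y * leg1 n A x) p q = y p.2 q.2 * x p.1 q.1 := by
  simp [leg1, leg2, Matrix.mul_apply, Fintype.sum_prod_type]

theorem flipMatrix_mul {n : ℕ} {A : Type*} [Ring A]
    (x : Matrix (Fin n × Fin n) (Fin n × Fin n) A) (p q : Fin n × Fin n) :
    (flipMatrix n A * x) p q = x p.swap q := by
  simp [flipMatrix, Matrix.mul_apply]

theorem mul_flipMatrix {n : ℕ} {A : Type*} [Ring A]
    (x : Matrix (Fin n × Fin n) (Fin n × Fin n) A) (p q : Fin n × Fin n) :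
    (x * flipMatrix n A) p q = x p q.swap := by
  have : ∀ z : Fin n × Fin n, (q = z.swap) = (z = q.swap) := fun z => by
    rw [eq_iff_iff, eq_comm, ← Prod.swap_inj, Prod.swap_swap]
  simp [flipMatrix, Matrix.mul_apply, this]

theorem TnegInv_rel (n : ℕ) (i j h k : Fin n) (r s : ℕ) :
    ((PowerSeries.coeff (r + 1) (TnegInv n)) i j * (PowerSeries.coeff s (TnegInv n)) h k
        - (PowerSeries.coeff s (TnegInv n)) h k * (PowerSeries.coeff (r + 1) (TnegInv n)) i j)
      - ((PowerSeries.coeff r (TnegInv n)) i j * (PowerSeries.coeff (s + 1) (TnegInv n)) h k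
        - (PowerSeries.coeff (s + 1) (TnegInv n)) h k * (PowerSeries.coeff r (TnegInv n)) i j)
    = (PowerSeries.coeff r (TnegInv n)) h j * (PowerSeries.coeff s (TnegInv n)) i k
      - (PowerSeries.coeff s (TnegInv n)) h j * (PowerSeries.coeff r (TnegInv n)) i k := by
  have key := rtt_inverse (flipMatrix n (Yangian n))
    (PowerSeries.map (leg1 n (Yangian n)) (Tneg n)) (PowerSeries.map (leg2 n (Yangian n)) (Tneg n))
    (PowerSeries.map (leg1 n (Yangian n)) (TnegInv n))
    (PowerSeries.map (leg2 n (Yangian n)) (TnegInv n))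
    (by rw [← map_mul, Tneg_mul_TnegInv, map_one]) (by rw [← map_mul, TnegInv_mul_Tneg, map_one])
    (by rw [← map_mul, Tneg_mul_TnegInv, map_one]) (by rw [← map_mul, TnegInv_mul_Tneg, map_one])
    (by rw [← PowerSeries.coeff_zero_eq_constantCoeff_apply, PowerSeries.coeff_map,
          PowerSeries.coeff_zero_eq_constantCoeff_apply, constantCoeff_Tneg, map_one])
    (by rw [← PowerSeries.coeff_zero_eq_constantCoeff_apply, PowerSeries.coeff_map,
          PowerSeries.coeff_zero_eq_constantCoeff_apply, constantCoeff_Tneg, map_one])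
    (by
      intro r s
      ext p q
      simp only [PowerSeries.coeff_map, Matrix.sub_apply, leg1_mul_leg2, leg2_mul_leg1,
        flipMatrix_mul, mul_flipMatrix, Tneg, PowerSeries.coeff_mk, Matrix.of_apply, Prod.fst_swap,
        Prod.snd_swap]
      have hT := T_rel n p.1 q.1 p.2 q.2 r s
      simp only [smul_mul_smul_comm, pow_succ]
      linear_combination (norm := module) (-((-1 : ℂ) ^ r * (-1) ^ s)) • hT)
    s r
  have h2 := congrFun (congrFun key (h, i)) (k, j)
  simp only [PowerSeries.coeff_map, Matrix.sub_apply, leg1_mul_leg2, leg2_mul_leg1,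
    flipMatrix_mul, mul_flipMatrix, Prod.swap_prod_mk] at h2
  rw [← h2]
  abel

/-- The automorphism `ω_n` of `Y_n` given by `T(u) ↦ T(-u)⁻¹`. -/
def omega (n : ℕ) : Yangian n →ₐ[ℂ] Yangian n :=
  lift (fun i j r => (PowerSeries.coeff r (TnegInv n)) i j)
    (fun i j => by rw [coeff_zero_TnegInv, Matrix.one_apply])
    (TnegInv_rel n)

/-- `ψ_m = ω_{m+n} ∘ φ_m ∘ ω_n : Y_n → Y_{m+n}`. -/
def psi (m n : ℕ) : Yangian n →ₐ[ℂ] Yangian (m + n) :=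
  (omega (m + n)).comp ((phi m n).comp (omega n))

/-- For `ν = (ν_0, …, ν_{m-1})` with sum `n`, the map `Y_{ν_a} → Y_n` onto the `a`-th block:
`ψ_{ν_0 + ⋯ + ν_{a-1}} : Y_{ν_a} → Y_{ν_0 + ⋯ + ν_a}` followed by the standard embedding into
`Y_n`. -/
def blockMap {m n : ℕ} (ν : Fin m → ℕ) (hν : ∑ a, ν a = n) (a : Fin m) :
    Yangian (ν a) →ₐ[ℂ] Yangian n :=
  (standardEmbedding (by
    rw [← hν, add_comm, ← Finset.sum_insert (f := ν) (Finset.notMem_Iio_self (b := a))]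
    exact Finset.sum_le_univ_sum_of_nonneg fun _ => Nat.zero_le _)).comp
  (psi (∑ b ∈ Finset.Iio a, ν b) (ν a))

/-- The standard Levi subalgebra
`Y_ν = Y_{ν_0} ψ_{ν_0}(Y_{ν_1}) ψ_{ν_0+ν_1}(Y_{ν_2}) ⋯` of `Y_n`: the subalgebra generated by all
the blocks. -/
def levi {m n : ℕ} (ν : Fin m → ℕ) (hν : ∑ a, ν a = n) : Subalgebra ℂ (Yangian n) :=
  ⨆ a, (blockMap ν hν a).range

end Yangian

end

/-! The inclusion of the centre in the centralizer is formal; what has to be shown is that the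
centralizer of `levi` lies in `levi` (`Yangian.centralizer_levi_le`). It suffices to find a
commutative subalgebra of `levi` that contains its own centralizer. The one used is generated by
elements `D_i^{(r)}` (`blockDiag`): inside each block `Y_{ν_a}` they are the images under `psi k 1`
of the generators of `Y_1`. They commute because entries of `T(u)` and of `T(v)⁻¹` with
complementary indices commute (`coeff_TnegInv_commute`), and `D_i^{(r)}` equals `T_{i,i}^{(r+1)}` up
to terms of smaller weight.

That this subalgebra contains its centralizer (`mem_adjoin_of_commute`) is seen on the associated
graded algebra. Giving `T_{i,j}^{(r+1)}` the weight `2r+1` makes it the symmetric algebra of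
`𝔤𝔩_n[t]` with the Lie–Poisson bracket. If `z` commutes with all `D_i^{(r)}`, its symbol Poisson
commutes with all `t_{i,i}^{(r)}`, and hence involves diagonal variables only
(`diag_of_bracket_eq_zero`): bracketing with a high power of `t` moves an off-diagonal variable
beyond those that occur. Substituting the `D_i^{(r)}` into the symbol gives an element of the
subalgebra with the same leading term as `z`; subtract it and induct on the weight.

Passing from commutators to brackets needs the linear independence of ordered monomials modulo
smaller weight (`eq_zero_of_orderedLift_mem`). It comes from a polynomial representation built from
products of shifted evaluation homomorphisms, whose leading symbols `∑_a c_a^r y^a_{i,j}` are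
algebraically independent by a Vandermonde argument. -/

noncomputable section

/-! ### Filtrations by weighted words, and ordered monomials -/

section WordFiltration

variable {K A ι : Type*} [Field K] [Ring A] [Algebra K A]

/-- The span of the words in the letters `g i` whose weight is less than `d`. -/
def wordFiltration (K : Type*) {A ι : Type*} [Field K] [Ring A] [Algebra K A]
    (g : ι → A) (w : ι → ℕ) (d : ℕ) : Submodule K A :=
  Submodule.span K {x | ∃ l : List ι, (l.map w).sum < d ∧ (l.map g).prod = x}

namespace wordFiltration

variable {g : ι → A} {w : ι → ℕ}

theorem word_mem (l : List ι) {d : ℕ} (h : (l.map w).sum < d) :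
    (l.map g).prod ∈ wordFiltration K g w d :=
  Submodule.subset_span ⟨l, h, rfl⟩

theorem mono {a b : ℕ} (h : a ≤ b) : wordFiltration K g w a ≤ wordFiltration K g w b :=
  Submodule.span_mono fun _ ⟨l, hl, hx⟩ => ⟨l, hl.trans_le h, hx⟩

theorem one_mem : (1 : A) ∈ wordFiltration K g w 1 := by
  simpa using word_mem (K := K) (g := g) (w := w) [] (d := 1) (by simp)

theorem letter_mem (i : ι) : g i ∈ wordFiltration K g w (w i + 1) := by
  simpa using word_mem (K := K) (g := g) (w := w) [i] (d := w i + 1) (by simp)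

theorem eq_zero_of_mem_zero {x : A} (hx : x ∈ wordFiltration K g w 0) : x = 0 := by
  simpa [wordFiltration] using hx

/-- Filtration indices are strict bounds: weights at most `a - 1` and at most `b` add up to less
than `a + b`. One index carries the shift so that no unit is lost in the product; `mul_mem'` shifts
the other factor. -/
theorem mul_mem {x y : A} {a b : ℕ} (hx : x ∈ wordFiltration K g w a)
    (hy : y ∈ wordFiltration K g w (b + 1)) : x * y ∈ wordFiltration K g w (a + b) := by
  induction hx using Submodule.span_induction with
  | zero => simp
  | add x x' _ _ h h' => rw [add_mul]; exact add_mem h h'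
  | smul c x _ h => rw [smul_mul_assoc]; exact Submodule.smul_mem _ _ h
  | mem x hx =>
    obtain ⟨l, hl, rfl⟩ := hx
    induction hy using Submodule.span_induction with
    | zero => simp
    | add x x' _ _ h h' => rw [mul_add]; exact add_mem h h'
    | smul c x _ h => rw [mul_smul_comm]; exact Submodule.smul_mem _ _ h
    | mem x hx =>
      obtain ⟨l', hl', rfl⟩ := hx
      rw [← List.prod_append, ← List.map_append]
      exact word_mem _ (by simp only [List.map_append, List.sum_append]; omega)

theorem mul_mem' {x y : A} {a b : ℕ} (hx : x ∈ wordFiltration K g w (a + 1))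
    (hy : y ∈ wordFiltration K g w b) : x * y ∈ wordFiltration K g w (a + b) := by
  rcases b with _ | b
  · simp [eq_zero_of_mem_zero hy]
  · exact mono (by omega) (mul_mem hx hy)

/-- An algebra homomorphism which does not raise the weight of letters preserves filtrations. -/
theorem map_mem {B κ : Type*} [Ring B] [Algebra K B] {g' : κ → B} {w' : κ → ℕ} (f : A →ₐ[K] B)
    (hf : ∀ i, f (g i) ∈ wordFiltration K g' w' (w i + 1)) {x : A} {d : ℕ}
    (hx : x ∈ wordFiltration K g w d) : f x ∈ wordFiltration K g' w' d := by
  induction hx using Submodule.span_induction with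
  | zero => simp
  | add x x' _ _ h h' => rw [map_add]; exact add_mem h h'
  | smul c x _ h => rw [map_smul]; exact Submodule.smul_mem _ _ h
  | mem x hx =>
    obtain ⟨l, hl, rfl⟩ := hx
    refine mono (Nat.succ_le_of_lt hl) ?_
    clear hl
    induction l with
    | nil => simpa using one_mem
    | cons i l ih =>
      simp only [List.map_cons, List.prod_cons, map_mul, List.sum_cons]
      exact mono (by omega) (mul_mem (hf i) ih)

/-- Telescoping: letters are exchanged one at a time, each exchange costing a term of smaller
weight. Hence the exchange does not affect leading terms. -/
theorem word_sub_word_mem {g' : ι → A} (h : ∀ i, g i - g' i ∈ wordFiltration K g w (w i))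
    (l : List ι) :
    (l.map g).prod - (l.map g').prod ∈ wordFiltration K g w (l.map w).sum := by
  induction l with
  | nil => simp
  | cons i l ih =>
    simp only [List.map_cons, List.prod_cons, List.sum_cons]
    have hl : (l.map g').prod ∈ wordFiltration K g w ((l.map w).sum + 1) := by
      rw [← sub_sub_cancel (l.map g).prod (l.map g').prod]
      exact sub_mem (word_mem l (Nat.lt_succ_self _)) (mono (Nat.le_succ _) ih)
    have e : g i * (l.map g).prod - g' i * (l.map g').prod
        = g i * ((l.map g).prod - (l.map g').prod) + (g i - g' i) * (l.map g').prod := by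
      noncomm_ring
    rw [e]
    exact add_mem (mul_mem' (letter_mem i) ih) (mul_mem (h i) hl)

theorem letter_comm_word
    (hcomm : ∀ i j, g i * g j - g j * g i ∈ wordFiltration K g w (w i + w j))
    (i : ι) (l : List ι) :
    g i * (l.map g).prod - (l.map g).prod * g i ∈ wordFiltration K g w (w i + (l.map w).sum) := by
  induction l with
  | nil => simp
  | cons j l ih =>
    simp only [List.map_cons, List.prod_cons, List.sum_cons]
    have e : g i * (g j * (l.map g).prod) - g j * (l.map g).prod * g i
        = (g i * g j - g j * g i) * (l.map g).prod
          + g j * (g i * (l.map g).prod - (l.map g).prod * g i) := by noncomm_ring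
    rw [e]
    exact add_mem (mono (by omega) (mul_mem (hcomm i j) (word_mem l (Nat.lt_succ_self _))))
      (mono (by omega) (mul_mem' (letter_mem j) ih))

theorem word_comm_word
    (hcomm : ∀ i j, g i * g j - g j * g i ∈ wordFiltration K g w (w i + w j))
    (l l' : List ι) :
    (l.map g).prod * (l'.map g).prod - (l'.map g).prod * (l.map g).prod
      ∈ wordFiltration K g w ((l.map w).sum + (l'.map w).sum) := by
  induction l with
  | nil => simp
  | cons j l ih =>
    simp only [List.map_cons, List.prod_cons, List.sum_cons]
    have e : g j * (l.map g).prod * (l'.map g).prod - (l'.map g).prod * (g j * (l.map g).prod)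
        = (g j * (l'.map g).prod - (l'.map g).prod * g j) * (l.map g).prod
          + g j * ((l.map g).prod * (l'.map g).prod - (l'.map g).prod * (l.map g).prod) := by
      noncomm_ring
    rw [e]
    exact add_mem (mono (by omega)
      (mul_mem (letter_comm_word hcomm j l') (word_mem l (Nat.lt_succ_self _))))
      (mono (by omega) (mul_mem' (letter_mem j) ih))

theorem comm_mem
    (hcomm : ∀ i j, g i * g j - g j * g i ∈ wordFiltration K g w (w i + w j))
    {x y : A} {a b : ℕ} (hx : x ∈ wordFiltration K g w (a + 1))
    (hy : y ∈ wordFiltration K g w (b + 1)) : x * y - y * x ∈ wordFiltration K g w (a + b) := by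
  induction hx using Submodule.span_induction with
  | zero => simp
  | add x x' _ _ h h' =>
    rw [add_mul, mul_add, add_sub_add_comm]; exact add_mem h h'
  | smul c x _ h =>
    rw [smul_mul_assoc, mul_smul_comm, ← smul_sub]; exact Submodule.smul_mem _ _ h
  | mem x hx =>
    obtain ⟨l, hl, rfl⟩ := hx
    induction hy using Submodule.span_induction with
    | zero => simp
    | add x x' _ _ h h' => rw [add_mul, mul_add, add_sub_add_comm]; exact add_mem h h'
    | smul c x _ h =>
      rw [smul_mul_assoc, mul_smul_comm, ← smul_sub]; exact Submodule.smul_mem _ _ h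
    | mem x hx =>
      obtain ⟨l', hl', rfl⟩ := hx
      exact mono (by omega) (word_comm_word hcomm l l')

/-- The associated graded algebra is commutative: each transposition of adjacent letters produces a
commutator, which has smaller weight than the two letters together. This makes the arbitrary order
chosen in `orderedLift` harmless. -/
theorem perm_sub_mem
    (hcomm : ∀ i j, g i * g j - g j * g i ∈ wordFiltration K g w (w i + w j))
    {l l' : List ι} (h : l.Perm l') :
    (l.map g).prod - (l'.map g).prod ∈ wordFiltration K g w (l.map w).sum := by
  induction h with
  | nil => simp
  | cons i h ih =>
    simp only [List.map_cons, List.prod_cons, List.sum_cons, ← mul_sub]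
    exact mul_mem' (letter_mem i) ih
  | swap i j l =>
    simp only [List.map_cons, List.prod_cons, List.sum_cons, ← mul_assoc, ← sub_mul]
    exact mono (by omega) (mul_mem (hcomm j i) (word_mem l (Nat.lt_succ_self _)))
  | trans h h' ih ih' =>
    rw [← sub_add_sub_cancel]
    exact add_mem ih (by rwa [(h.map w).sum_eq])

end wordFiltration

/-- The linear map sending a monomial to the product, in some fixed order, of its letters. -/
def orderedLift (K : Type*) {A ι : Type*} [Field K] [Ring A] [Algebra K A] (g : ι → A) :
    MvPolynomial ι K →ₗ[K] A :=
  (MvPolynomial.basisMonomials ι K).constr K fun m => ((Finsupp.toMultiset m).toList.map g).prod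

open MvPolynomial

theorem orderedLift_monomial (g : ι → A) (m : ι →₀ ℕ) (c : K) :
    orderedLift K g (monomial m c) = c • ((Finsupp.toMultiset m).toList.map g).prod := by
  have h : (monomial m c : MvPolynomial ι K) = c • basisMonomials ι K m := by
    simp [smul_monomial]
  rw [h, map_smul, orderedLift, Module.Basis.constr_basis]

theorem sum_map_toList_toMultiset (w : ι → ℕ) (m : ι →₀ ℕ) :
    ((Finsupp.toMultiset m).toList.map w).sum = Finsupp.weight w m := by
  classical
  rw [← Multiset.sum_coe, ← Multiset.map_coe, Multiset.coe_toList, Finsupp.toMultiset_map]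
  induction m using Finsupp.induction_linear with
  | zero => simp
  | add f g hf hg => simp [Finsupp.mapDomain_add, hf, hg]
  | single a b => simp [Finsupp.weight_single, Multiset.sum_nsmul]

end WordFiltration

/-! ### Symbols: from the polynomial ring to the associated graded algebra -/

section OrderedLift

open MvPolynomial

variable {K A ι : Type*} [Field K] [Ring A] [Algebra K A] {g : ι → A} {w : ι → ℕ}

theorem orderedLift_mem {f : MvPolynomial ι K} {d : ℕ} (hf : IsWeightedHomogeneous w f d) :
    orderedLift K g f ∈ wordFiltration K g w (d + 1) := by
  rw [f.as_sum, map_sum]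
  refine sum_mem fun m hm => ?_
  rw [orderedLift_monomial]
  refine Submodule.smul_mem _ _ (wordFiltration.word_mem _ ?_)
  rw [sum_map_toList_toMultiset, hf (mem_support_iff.mp hm)]
  exact Nat.lt_succ_self d

theorem list_prod_X [DecidableEq ι] (l : List ι) :
    (l.map (X : ι → MvPolynomial ι K)).prod
      = monomial (Multiset.toFinsupp (l : Multiset ι)) 1 := by
  induction l with
  | nil => simp
  | cons i l ih =>
    rw [List.map_cons, List.prod_cons, ih, ← Multiset.cons_coe, ← Multiset.singleton_add,
      Multiset.toFinsupp_add, Multiset.toFinsupp_singleton, X, monomial_mul, one_mul]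

theorem isWeightedHomogeneous_list_prod_X (l : List ι) :
    IsWeightedHomogeneous w (l.map (X : ι → MvPolynomial ι K)).prod (l.map w).sum := by
  induction l with
  | nil => simpa using isWeightedHomogeneous_one K w
  | cons i l ih =>
    simp only [List.map_cons, List.prod_cons, List.sum_cons]
    exact (isWeightedHomogeneous_X K w i).mul ih

theorem orderedLift_sub_orderedLift_mem {g' : ι → A}
    (h : ∀ i, g i - g' i ∈ wordFiltration K g w (w i)) {f : MvPolynomial ι K} {d : ℕ}
    (hf : IsWeightedHomogeneous w f d) :
    orderedLift K g f - orderedLift K g' f ∈ wordFiltration K g w d := by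
  rw [f.as_sum, map_sum, map_sum, ← Finset.sum_sub_distrib]
  refine sum_mem fun m hm => ?_
  rw [orderedLift_monomial, orderedLift_monomial, ← smul_sub]
  refine Submodule.smul_mem _ _ ?_
  have := wordFiltration.word_sub_word_mem h (Finsupp.toMultiset m).toList
  rwa [sum_map_toList_toMultiset, hf (mem_support_iff.mp hm)] at this

theorem orderedLift_list_prod
    (hcomm : ∀ i j, g i * g j - g j * g i ∈ wordFiltration K g w (w i + w j))
    (l : List ι) :
    orderedLift K g (l.map X).prod - (l.map g).prod ∈ wordFiltration K g w (l.map w).sum := by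
  classical
  rw [list_prod_X, orderedLift_monomial, one_smul]
  have hp : (Finsupp.toMultiset (Multiset.toFinsupp (l : Multiset ι))).toList.Perm l := by
    rw [← Multiset.coe_eq_coe, Multiset.coe_toList, Multiset.toFinsupp_toMultiset]
  have := wordFiltration.perm_sub_mem (K := K) hcomm hp
  rwa [(hp.map w).sum_eq] at this

/-- The homogeneous polynomials map onto the associated graded algebra. A word of weight exactly `d`
has as symbol the commutative monomial in the same letters; a shorter one has symbol zero. -/
theorem exists_symbol
    (hcomm : ∀ i j, g i * g j - g j * g i ∈ wordFiltration K g w (w i + w j))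
    {x : A} {d : ℕ} (hx : x ∈ wordFiltration K g w (d + 1)) :
    ∃ f : MvPolynomial ι K, IsWeightedHomogeneous w f d ∧
      x - orderedLift K g f ∈ wordFiltration K g w d := by
  induction hx using Submodule.span_induction with
  | zero => exact ⟨0, isWeightedHomogeneous_zero K w d, by simp⟩
  | add x x' _ _ h h' =>
    obtain ⟨f, hf, hx⟩ := h
    obtain ⟨f', hf', hx'⟩ := h'
    refine ⟨f + f', hf.add hf', ?_⟩
    rw [map_add, add_sub_add_comm]
    exact add_mem hx hx'
  | smul c x _ h =>
    obtain ⟨f, hf, hx⟩ := h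
    refine ⟨c • f, (weightedHomogeneousSubmodule K w d).smul_mem c hf, ?_⟩
    rw [map_smul, ← smul_sub]
    exact Submodule.smul_mem _ _ hx
  | mem x hx =>
    obtain ⟨l, hl, rfl⟩ := hx
    rcases Nat.lt_succ_iff_lt_or_eq.mp hl with hl | rfl
    · exact ⟨0, isWeightedHomogeneous_zero K w d, by
        simpa using wordFiltration.word_mem l hl⟩
    · refine ⟨(l.map X).prod, isWeightedHomogeneous_list_prod_X l, ?_⟩
      rw [← neg_sub]
      exact neg_mem (orderedLift_list_prod hcomm l)

/-- Concatenating two ordered words gives a permutation of the ordered word of the product, so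
`perm_sub_mem` applies monomial by monomial. -/
theorem orderedLift_mul_sub_mem
    (hcomm : ∀ i j, g i * g j - g j * g i ∈ wordFiltration K g w (w i + w j))
    {f f' : MvPolynomial ι K} {d d' : ℕ}
    (hf : IsWeightedHomogeneous w f d) (hf' : IsWeightedHomogeneous w f' d') :
    orderedLift K g (f * f') - orderedLift K g f * orderedLift K g f'
      ∈ wordFiltration K g w (d + d') := by
  have key : ∀ m m' : ι →₀ ℕ, Finsupp.weight w m = d → Finsupp.weight w m' = d' → ∀ c c' : K,
      orderedLift K g (monomial m c * monomial m' c')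
        - orderedLift K g (monomial m c) * orderedLift K g (monomial m' c')
      ∈ wordFiltration K g w (d + d') := by
    intro m m' hm hm' c c'
    rw [monomial_mul, orderedLift_monomial, orderedLift_monomial, orderedLift_monomial,
      smul_mul_smul_comm, ← smul_sub]
    refine Submodule.smul_mem _ _ ?_
    rw [← List.prod_append, ← List.map_append]
    have hp : (Finsupp.toMultiset (m + m')).toList.Perm
        ((Finsupp.toMultiset m).toList ++ (Finsupp.toMultiset m').toList) := by
      rw [← Multiset.coe_eq_coe, ← Multiset.coe_add, Multiset.coe_toList, Multiset.coe_toList,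
        Multiset.coe_toList, Finsupp.toMultiset_add]
    have := wordFiltration.perm_sub_mem (K := K) hcomm hp
    rwa [sum_map_toList_toMultiset, map_add, hm, hm'] at this
  have e : orderedLift K g (f * f') - orderedLift K g f * orderedLift K g f'
      = ∑ m ∈ f.support, ∑ m' ∈ f'.support,
        (orderedLift K g (monomial m (coeff m f) * monomial m' (coeff m' f'))
          - orderedLift K g (monomial m (coeff m f))
            * orderedLift K g (monomial m' (coeff m' f'))) := by
    simp only [Finset.sum_sub_distrib]
    simp only [← Finset.mul_sum, ← Finset.sum_mul, ← map_sum]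
    simp only [← as_sum]
  rw [e]
  exact sum_mem fun m hm => sum_mem fun m' hm' =>
    key m m' (hf (mem_support_iff.mp hm)) (hf' (mem_support_iff.mp hm')) _ _

/-- The commutator with `x` is a derivation, hence so is the map it induces on symbols, which is
determined by its values `δ j` on the letters. With `x` of weight `a + 1`, commutators lose one
unit, whence the degree shift `a`. -/
theorem comm_orderedLift_sub_mem
    (hcomm : ∀ i j, g i * g j - g j * g i ∈ wordFiltration K g w (w i + w j))
    {x : A} {a : ℕ} {δ : ι → MvPolynomial ι K}
    (hδ : ∀ j, IsWeightedHomogeneous w (δ j) (a + w j))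
    (hx : ∀ j, x * g j - g j * x - orderedLift K g (δ j) ∈ wordFiltration K g w (a + w j))
    {f : MvPolynomial ι K} {d : ℕ} (hf : IsWeightedHomogeneous w f d) :
    IsWeightedHomogeneous w (mkDerivation K δ f) (a + d) ∧
    x * orderedLift K g f - orderedLift K g f * x - orderedLift K g (mkDerivation K δ f)
      ∈ wordFiltration K g w (a + d) := by
  have hD : ∀ l : List ι, IsWeightedHomogeneous w
      (mkDerivation K δ (l.map X).prod) (a + (l.map w).sum) := by
    intro l
    induction l with
    | nil => simpa using isWeightedHomogeneous_zero K w _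
    | cons j l ih =>
      simp only [List.map_cons, List.prod_cons, List.sum_cons, Derivation.leibniz, mkDerivation_X,
        smul_eq_mul]
      refine IsWeightedHomogeneous.add ?_ ?_
      · have := (isWeightedHomogeneous_X K w j).mul ih
        rwa [add_left_comm] at this
      · have := (isWeightedHomogeneous_list_prod_X (K := K) (w := w) l).mul (hδ j)
        rwa [add_comm, add_assoc] at this
  have hword : ∀ l : List ι, x * (l.map g).prod - (l.map g).prod * x
      - orderedLift K g (mkDerivation K δ (l.map X).prod)
      ∈ wordFiltration K g w (a + (l.map w).sum) := by
    intro l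
    induction l with
    | nil => simp
    | cons j l ih =>
      simp only [List.map_cons, List.prod_cons, List.sum_cons, Derivation.leibniz, mkDerivation_X,
        smul_eq_mul, map_add]
      set p := (l.map g).prod
      set q := (l.map (X : ι → MvPolynomial ι K)).prod
      set Dq := mkDerivation K δ q
      have hq : IsWeightedHomogeneous w q (l.map w).sum := isWeightedHomogeneous_list_prod_X l
      have e : x * (g j * p) - g j * p * x
          - (orderedLift K g (X j * Dq) + orderedLift K g (q * δ j))
          -- The Leibniz rule for the commutator, minus its polynomial counterpart. Each summand
          -- contains one error factor of smaller weight: `hx`, the induction hypothesis, or a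
          -- failure of `orderedLift` to be multiplicative or to match a word.
          = (x * g j - g j * x - orderedLift K g (δ j)) * p
            - orderedLift K g (δ j) * (orderedLift K g q - p)
            - (orderedLift K g (δ j * q) - orderedLift K g (δ j) * orderedLift K g q)
            + g j * (x * p - p * x - orderedLift K g Dq)
            - (orderedLift K g (X j) - g j) * orderedLift K g Dq
            - (orderedLift K g (X j * Dq) - orderedLift K g (X j) * orderedLift K g Dq) := by
        rw [mul_comm q]
        noncomm_ring
      rw [e]
      have hX : orderedLift K g (X j) - g j ∈ wordFiltration K g w (w j) := by
        simpa using orderedLift_list_prod (K := K) hcomm [j]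
      refine sub_mem (sub_mem (add_mem (sub_mem (sub_mem ?_ ?_) ?_) ?_) ?_) ?_
      · exact wordFiltration.mono (by omega)
          (wordFiltration.mul_mem (hx j) (wordFiltration.word_mem l (Nat.lt_succ_self _)))
      · exact wordFiltration.mono (by omega)
          (wordFiltration.mul_mem' (orderedLift_mem (hδ j)) (orderedLift_list_prod hcomm l))
      · exact wordFiltration.mono (by omega) (orderedLift_mul_sub_mem hcomm (hδ j) hq)
      · exact wordFiltration.mono (by omega)
          (wordFiltration.mul_mem' (wordFiltration.letter_mem j) ih)
      · exact wordFiltration.mono (by omega)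
          (wordFiltration.mul_mem hX (orderedLift_mem (hD l)))
      · exact wordFiltration.mono (by omega)
          (orderedLift_mul_sub_mem hcomm (isWeightedHomogeneous_X K w j) (hD l))
  have hmon : ∀ m : ι →₀ ℕ, (monomial m (1 : K))
      = ((Finsupp.toMultiset m).toList.map X).prod := by
    classical
    intro m
    rw [list_prod_X, Multiset.coe_toList, Finsupp.toMultiset_toFinsupp]
  have hsum : f = ∑ m ∈ f.support, coeff m f • ((Finsupp.toMultiset m).toList.map X).prod := by
    conv_lhs => rw [f.as_sum]
    refine Finset.sum_congr rfl fun m _ => ?_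
    rw [← hmon, smul_monomial, smul_eq_mul, mul_one]
  have hw : ∀ m ∈ f.support, ((Finsupp.toMultiset m).toList.map w).sum = d := fun m hm => by
    rw [sum_map_toList_toMultiset, hf (mem_support_iff.mp hm)]
  constructor
  · rw [hsum, map_sum]
    refine IsWeightedHomogeneous.sum _ _ _ fun m hm => ?_
    rw [Derivation.map_smul, ← hw m hm]
    exact (weightedHomogeneousSubmodule K w _).smul_mem _ (hD _)
  · conv in (mkDerivation K δ f) => rw [hsum]
    have ef : orderedLift K g f
        = ∑ m ∈ f.support, coeff m f • ((Finsupp.toMultiset m).toList.map g).prod := by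
      conv_lhs => rw [f.as_sum]
      rw [map_sum]
      exact Finset.sum_congr rfl fun m _ => orderedLift_monomial _ _ _
    rw [ef, map_sum, map_sum, Finset.mul_sum, Finset.sum_mul, ← Finset.sum_sub_distrib,
      ← Finset.sum_sub_distrib]
    refine sum_mem fun m hm => ?_
    rw [Derivation.map_smul, map_smul, mul_smul_comm, smul_mul_assoc, ← smul_sub, ← smul_sub,
      ← hw m hm]
    exact Submodule.smul_mem _ _ (hword _)

end OrderedLift

/-! ### The RTT relation in series form, products of families, complementary indices -/

namespace Yangian

/-- The coefficientwise form of the ternary relation is equivalent to the bivariate identity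
`R a(x) b(y) = b(y) a(x) R` with `R = y - x + x y P`. -/
theorem rtt_series_iff {M : Type*} [Ring M] (P : M) (a b : PowerSeries M)
    (a0 : PowerSeries.coeff 0 a = 1) (b0 : PowerSeries.coeff 0 b = 1) :
    ((PowerSeries.X - PowerSeries.C PowerSeries.X
          + PowerSeries.X * PowerSeries.C PowerSeries.X * PowerSeries.C (PowerSeries.C P))
        * (PowerSeries.C a * PowerSeries.map PowerSeries.C b)
      = (PowerSeries.map PowerSeries.C b * PowerSeries.C a)
        * (PowerSeries.X - PowerSeries.C PowerSeries.X
          + PowerSeries.X * PowerSeries.C PowerSeries.X * PowerSeries.C (PowerSeries.C P))) ↔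
    ∀ r s,
      (PowerSeries.coeff (r + 1) a * PowerSeries.coeff s b
          - PowerSeries.coeff s b * PowerSeries.coeff (r + 1) a)
        - (PowerSeries.coeff r a * PowerSeries.coeff (s + 1) b
          - PowerSeries.coeff (s + 1) b * PowerSeries.coeff r a)
      = PowerSeries.coeff s b * PowerSeries.coeff r a * P
        - P * (PowerSeries.coeff r a * PowerSeries.coeff s b) := by
  have hx : ∀ q : PowerSeries (PowerSeries M),
      q * PowerSeries.C PowerSeries.X = PowerSeries.C PowerSeries.X * q := by
    intro q
    ext1 s
    simp only [PowerSeries.coeff_mul_C, PowerSeries.coeff_C_mul]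
    exact (PowerSeries.commute_X _).eq
  have hy : ∀ q : PowerSeries (PowerSeries M), q * PowerSeries.X = PowerSeries.X * q :=
    fun q => (PowerSeries.commute_X q).eq
  have e1 : ∀ y x p q : PowerSeries (PowerSeries M), (y - x + y * x * p) * q
      = y * q - x * q + y * (x * (p * q)) := by intros; noncomm_ring
  have e2 : ∀ p q : PowerSeries (PowerSeries M),
      q * (PowerSeries.X - PowerSeries.C PowerSeries.X
        + PowerSeries.X * PowerSeries.C PowerSeries.X * p)
      = PowerSeries.X * q - PowerSeries.C PowerSeries.X * q
        + PowerSeries.X * (PowerSeries.C PowerSeries.X * (q * p)) := by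
    intro p q
    rw [mul_add, mul_sub, hy, hx, ← mul_assoc _ _ p, ← mul_assoc _ PowerSeries.X _, hy,
      mul_assoc PowerSeries.X _ _, hx]
    simp only [mul_assoc]
  rw [e1, e2]
  constructor
  · intro h r s
    have h4 := congrArg (fun q => PowerSeries.coeff (r + 1) (PowerSeries.coeff (s + 1) q)) h
    simp only [map_add, map_sub, PowerSeries.coeff_succ_X_mul, PowerSeries.coeff_C_mul,
      PowerSeries.coeff_mul_C, PowerSeries.coeff_map] at h4
    grind
  · intro hab
    ext s r
    -- The hypothesis only covers coefficients with both exponents positive. The boundary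
    -- coefficients agree because both constant terms are `1`.
    rcases s with _ | s <;> rcases r with _ | r
    · simp [mul_assoc]
    · simp only [map_add, map_sub, PowerSeries.coeff_succ_X_mul, PowerSeries.coeff_C_mul,
        PowerSeries.coeff_mul_C, PowerSeries.coeff_map, PowerSeries.coeff_zero_X_mul, b0]
      simp
    · simp only [map_add, map_sub, PowerSeries.coeff_succ_X_mul, PowerSeries.coeff_C_mul,
        PowerSeries.coeff_mul_C, PowerSeries.coeff_map, PowerSeries.coeff_zero_X_mul, a0]
      simp
    · have := hab r s
      simp only [map_add, map_sub, PowerSeries.coeff_succ_X_mul,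
        PowerSeries.coeff_C_mul, PowerSeries.coeff_mul_C, PowerSeries.coeff_map]
      grind

/-- The relation between the coefficients of `a(x)` and of the inverse of `b(y)`. -/
theorem rtt_half_inverse {M : Type*} [Ring M] (P : M) (a b b' : PowerSeries M)
    (hb : b * b' = 1) (hb' : b' * b = 1)
    (a0 : PowerSeries.coeff 0 a = 1) (b0 : PowerSeries.coeff 0 b = 1)
    (hab : ∀ r s,
      (PowerSeries.coeff (r + 1) a * PowerSeries.coeff s b
          - PowerSeries.coeff s b * PowerSeries.coeff (r + 1) a)
        - (PowerSeries.coeff r a * PowerSeries.coeff (s + 1) b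
          - PowerSeries.coeff (s + 1) b * PowerSeries.coeff r a)
      = PowerSeries.coeff s b * PowerSeries.coeff r a * P
        - P * (PowerSeries.coeff r a * PowerSeries.coeff s b)) (r s : ℕ) :
    PowerSeries.coeff s b' * PowerSeries.coeff (r + 1) a
        - PowerSeries.coeff (s + 1) b' * PowerSeries.coeff r a
        + PowerSeries.coeff s b' * (P * PowerSeries.coeff r a)
      = PowerSeries.coeff (r + 1) a * PowerSeries.coeff s b'
        - PowerSeries.coeff r a * PowerSeries.coeff (s + 1) b'
        + PowerSeries.coeff r a * (P * PowerSeries.coeff s b') := by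
  have h1 := (rtt_series_iff P a b a0 b0).mpr hab
  set α : PowerSeries (PowerSeries M) := PowerSeries.C a with hα
  set β : PowerSeries (PowerSeries M) := PowerSeries.map PowerSeries.C b with hβ
  set β' : PowerSeries (PowerSeries M) := PowerSeries.map PowerSeries.C b' with hβ'
  set p : PowerSeries (PowerSeries M) := PowerSeries.C (PowerSeries.C P) with hp
  have eb : β * β' = 1 := by rw [← map_mul, hb, map_one]
  have eb' : β' * β = 1 := by rw [← map_mul, hb', map_one]
  have hx : ∀ q : PowerSeries (PowerSeries M),
      q * PowerSeries.C PowerSeries.X = PowerSeries.C PowerSeries.X * q := by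
    intro q
    ext1 s
    simp only [PowerSeries.coeff_mul_C, PowerSeries.coeff_C_mul]
    exact (PowerSeries.commute_X _).eq
  have hy : ∀ q : PowerSeries (PowerSeries M), q * PowerSeries.X = PowerSeries.X * q :=
    fun q => (PowerSeries.commute_X q).eq
  have e2 : ∀ q q' : PowerSeries (PowerSeries M),
      q * (PowerSeries.X - PowerSeries.C PowerSeries.X
        + PowerSeries.X * PowerSeries.C PowerSeries.X * p) * q'
      = PowerSeries.X * (q * q') - PowerSeries.C PowerSeries.X * (q * q')
        + PowerSeries.X * (PowerSeries.C PowerSeries.X * (q * (p * q'))) := by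
    intro q q'
    rw [mul_add, mul_sub, hy, hx, ← mul_assoc _ _ p, ← mul_assoc _ PowerSeries.X _, hy,
      mul_assoc PowerSeries.X _ _, hx]
    simp only [mul_assoc, add_mul, sub_mul]
  have h2 : β' * (PowerSeries.X - PowerSeries.C PowerSeries.X
        + PowerSeries.X * PowerSeries.C PowerSeries.X * p) * α
      = α * (PowerSeries.X - PowerSeries.C PowerSeries.X
        + PowerSeries.X * PowerSeries.C PowerSeries.X * p) * β' := by
    generalize PowerSeries.X - PowerSeries.C PowerSeries.X
        + PowerSeries.X * PowerSeries.C PowerSeries.X * p = R at h1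
    -- Multiplying `R a b = b a R` by `b⁻¹` on both sides inverts only one of the two series.
    calc β' * R * α = β' * (R * (α * β)) * β' := by simp only [mul_assoc, eb, mul_one]
      _ = (β' * β) * α * R * β' := by rw [h1]; simp only [mul_assoc]
      _ = _ := by rw [eb', one_mul]
  rw [e2, e2, ← mul_assoc β'] at h2
  have hC : ∀ x y : M, PowerSeries.coeff r (a * (PowerSeries.C x * PowerSeries.C y))
      = PowerSeries.coeff r a * (x * y) := by
    intro x y
    rw [← map_mul, PowerSeries.coeff_mul_C]
  have h4 := congrArg (fun q => PowerSeries.coeff (r + 1) (PowerSeries.coeff (s + 1) q)) h2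
  simp only [hα, hβ', hp, map_add, map_sub, PowerSeries.coeff_succ_X_mul, PowerSeries.coeff_C_mul,
    PowerSeries.coeff_mul_C, PowerSeries.coeff_map, hC] at h4
  simpa only [mul_assoc, PowerSeries.coeff_C_mul] using h4

/-- A family of elements satisfying the defining relations of the Yangian. -/
structure IsRTT {n : ℕ} {A : Type*} [Ring A] (S : Fin n → Fin n → ℕ → A) : Prop where
  zero : ∀ i j, S i j 0 = if i = j then 1 else 0
  rel : ∀ i j h k r s,
      (S i j (r + 1) * S h k s - S h k s * S i j (r + 1))
        - (S i j r * S h k (s + 1) - S h k (s + 1) * S i j r)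
      = S h j r * S i k s - S h j s * S i k r

/-- The generating series of a family, as a power series with matrix coefficients. -/
def genSeries {n : ℕ} {A : Type*} [Ring A] (S : Fin n → Fin n → ℕ → A) :
    PowerSeries (Matrix (Fin n) (Fin n) A) :=
  PowerSeries.mk fun r => Matrix.of fun i j => S i j r

theorem coeff_zero_genSeries {n : ℕ} {A : Type*} [Ring A] {S : Fin n → Fin n → ℕ → A}
    (h0 : ∀ i j, S i j 0 = if i = j then 1 else 0) : PowerSeries.coeff 0 (genSeries S) = 1 := by
  ext i j
  simp [genSeries, h0, Matrix.one_apply]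

/-- The sign of `flipMatrix` is negative here because the relations are those of `T(u)`; the
substitution `u ↦ -u` used for `Tneg` reverses it. -/
theorem rel_iff_series {n : ℕ} {A : Type*} [Ring A] (S : Fin n → Fin n → ℕ → A) :
    (∀ i j h k r s,
      (S i j (r + 1) * S h k s - S h k s * S i j (r + 1))
        - (S i j r * S h k (s + 1) - S h k (s + 1) * S i j r)
      = S h j r * S i k s - S h j s * S i k r) ↔
    ∀ r s,
      (PowerSeries.coeff (r + 1) (PowerSeries.map (leg1 n A) (genSeries S))
          * PowerSeries.coeff s (PowerSeries.map (leg2 n A) (genSeries S))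
          - PowerSeries.coeff s (PowerSeries.map (leg2 n A) (genSeries S))
            * PowerSeries.coeff (r + 1) (PowerSeries.map (leg1 n A) (genSeries S)))
        - (PowerSeries.coeff r (PowerSeries.map (leg1 n A) (genSeries S))
          * PowerSeries.coeff (s + 1) (PowerSeries.map (leg2 n A) (genSeries S))
          - PowerSeries.coeff (s + 1) (PowerSeries.map (leg2 n A) (genSeries S))
            * PowerSeries.coeff r (PowerSeries.map (leg1 n A) (genSeries S)))
      = PowerSeries.coeff s (PowerSeries.map (leg2 n A) (genSeries S))
          * PowerSeries.coeff r (PowerSeries.map (leg1 n A) (genSeries S)) * (-flipMatrix n A)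
        - (-flipMatrix n A) * (PowerSeries.coeff r (PowerSeries.map (leg1 n A) (genSeries S))
          * PowerSeries.coeff s (PowerSeries.map (leg2 n A) (genSeries S))) := by
  simp only [← Matrix.ext_iff, PowerSeries.coeff_map, Matrix.sub_apply, leg1_mul_leg2,
    leg2_mul_leg1, mul_neg, neg_mul, Matrix.neg_apply, flipMatrix_mul, mul_flipMatrix, genSeries,
    PowerSeries.coeff_mk, Matrix.of_apply, Prod.fst_swap, Prod.snd_swap, Prod.forall]
  constructor
  · intro H r s i h j k
    rw [H i j h k r s]
    abel
  · intro H i j h k r s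
    rw [H r s i h j k]
    abel

/-- The matrix product of two families. -/
def mulFamily {n : ℕ} {A : Type*} [Ring A] (S S' : Fin n → Fin n → ℕ → A) (i j : Fin n) (r : ℕ) :
    A :=
  ∑ p ∈ Finset.HasAntidiagonal.antidiagonal r, ∑ k, S i k p.1 * S' k j p.2

theorem genSeries_mulFamily {n : ℕ} {A : Type*} [Ring A] (S S' : Fin n → Fin n → ℕ → A) :
    genSeries (mulFamily S S') = genSeries S * genSeries S' := by
  ext r i j
  simp [genSeries, mulFamily, PowerSeries.coeff_mul, Matrix.sum_apply, Matrix.mul_apply]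

/-- This is the coproduct of the Yangian: since entries of the two factors commute, `R` can be moved
past `a a' b b' = (a b)(a' b')` using the two RTT relations in turn. -/
theorem IsRTT.mulFamily {n : ℕ} {A : Type*} [Ring A] {S S' : Fin n → Fin n → ℕ → A}
    (hS : IsRTT S) (hS' : IsRTT S') (hc : ∀ i j h k r s, Commute (S i j r) (S' h k s)) :
    IsRTT (mulFamily S S') := by
  have h0 : ∀ i j, Yangian.mulFamily S S' i j 0 = if i = j then 1 else 0 := by
    intro i j
    simp [Yangian.mulFamily, hS.zero, hS'.zero]
  refine ⟨h0, ?_⟩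
  have one1 : ∀ U : Fin n → Fin n → ℕ → A, (∀ i j, U i j 0 = if i = j then 1 else 0) →
      PowerSeries.coeff 0 (PowerSeries.map (leg1 n A) (genSeries U)) = 1 := fun U hU => by
    rw [PowerSeries.coeff_map, coeff_zero_genSeries hU, map_one]
  have one2 : ∀ U : Fin n → Fin n → ℕ → A, (∀ i j, U i j 0 = if i = j then 1 else 0) →
      PowerSeries.coeff 0 (PowerSeries.map (leg2 n A) (genSeries U)) = 1 := fun U hU => by
    rw [PowerSeries.coeff_map, coeff_zero_genSeries hU, map_one]
  rw [rel_iff_series, ← rtt_series_iff _ _ _ (one1 _ h0) (one2 _ h0)]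
  have h1 := (rtt_series_iff _ _ _ (one1 _ hS.zero) (one2 _ hS.zero)).mpr
    ((rel_iff_series S).mp hS.rel)
  have h2 := (rtt_series_iff _ _ _ (one1 _ hS'.zero) (one2 _ hS'.zero)).mpr
    ((rel_iff_series S').mp hS'.rel)
  have hcomm : ∀ (U V : Fin n → Fin n → ℕ → A)
      (_ : ∀ i j h k r s, Commute (U i j r) (V h k s)),
      PowerSeries.map PowerSeries.C (PowerSeries.map (leg2 n A) (genSeries V))
        * PowerSeries.C (PowerSeries.map (leg1 n A) (genSeries U))
      = PowerSeries.C (PowerSeries.map (leg1 n A) (genSeries U))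
        * PowerSeries.map PowerSeries.C (PowerSeries.map (leg2 n A) (genSeries V)) := by
    intro U V hUV
    ext s r p q
    simp only [PowerSeries.coeff_mul_C, PowerSeries.coeff_C_mul, PowerSeries.coeff_map,
      leg1_mul_leg2, leg2_mul_leg1, genSeries, PowerSeries.coeff_mk, Matrix.of_apply]
    exact (hUV _ _ _ _ _ _).eq.symm
  have c1 := hcomm S S' hc
  have c2 := hcomm S' S fun i j h k r s => (hc h k i j s r).symm
  rw [genSeries_mulFamily, map_mul, map_mul, map_mul, map_mul]
  generalize PowerSeries.X - PowerSeries.C PowerSeries.X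
        + PowerSeries.X * PowerSeries.C PowerSeries.X * PowerSeries.C (PowerSeries.C
          (-flipMatrix n A)) = R at h1 h2 ⊢
  generalize PowerSeries.C (PowerSeries.map (leg1 n A) (genSeries S)) = a at *
  generalize PowerSeries.C (PowerSeries.map (leg1 n A) (genSeries S')) = a' at *
  generalize PowerSeries.map PowerSeries.C (PowerSeries.map (leg2 n A) (genSeries S)) = b at *
  generalize PowerSeries.map PowerSeries.C (PowerSeries.map (leg2 n A) (genSeries S')) = b' at *
  calc R * (a * a' * (b * b')) = R * (a * (a' * b) * b') := by simp only [mul_assoc]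
    _ = R * (a * b) * (a' * b') := by rw [← c2]; simp only [mul_assoc]
    _ = b * a * (R * (a' * b')) := by rw [h1]; simp only [mul_assoc]
    _ = b * (a * b') * a' * R := by rw [h2]; simp only [mul_assoc]
    _ = b * b' * (a * a') * R := by rw [← c1]; simp only [mul_assoc]

/-- In `b⁻¹ R a = a R b⁻¹`, the `P` terms at the entry `(i, h), (j, k)` vanish, one because `i ≠ k`
and the other because `j ≠ h`. What is left says that `u - v` times the commutator is zero, which is
unwound by trading `(r + 1, s)` for `(r, s + 1)` until the scalar `r = 0` is reached. -/
theorem coeff_TnegInv_commute {n : ℕ} {i j h k : Fin n} (hik : i ≠ k) (hjh : j ≠ h) (r s : ℕ) :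
    Commute (T n i j r) (PowerSeries.coeff s (TnegInv n) h k) := by
  have key := rtt_half_inverse (flipMatrix n (Yangian n))
    (PowerSeries.map (leg1 n (Yangian n)) (Tneg n)) (PowerSeries.map (leg2 n (Yangian n)) (Tneg n))
    (PowerSeries.map (leg2 n (Yangian n)) (TnegInv n))
    (by rw [← map_mul, Tneg_mul_TnegInv, map_one]) (by rw [← map_mul, TnegInv_mul_Tneg, map_one])
    (by rw [PowerSeries.coeff_map,
          PowerSeries.coeff_zero_eq_constantCoeff_apply, constantCoeff_Tneg, map_one])
    (by rw [PowerSeries.coeff_map,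
          PowerSeries.coeff_zero_eq_constantCoeff_apply, constantCoeff_Tneg, map_one])
    (by
      intro r s
      ext p q
      simp only [PowerSeries.coeff_map, Matrix.sub_apply, leg1_mul_leg2, leg2_mul_leg1,
        flipMatrix_mul, mul_flipMatrix, Tneg, PowerSeries.coeff_mk, Matrix.of_apply, Prod.fst_swap,
        Prod.snd_swap]
      have hT := T_rel n p.1 q.1 p.2 q.2 r s
      simp only [smul_mul_smul_comm, pow_succ]
      linear_combination (norm := module) (-((-1 : ℂ) ^ r * (-1) ^ s)) • hT)
  have hP1 : ∀ x y : Matrix (Fin n) (Fin n) (Yangian n),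
      (leg2 n (Yangian n) x * (flipMatrix n (Yangian n) * leg1 n (Yangian n) y))
        (i, h) (j, k) = 0 := by
    intro x y
    rw [Matrix.mul_apply]
    refine Finset.sum_eq_zero fun p _ => ?_
    rw [flipMatrix_mul]
    by_cases hp : i = p.1
    · simp [leg1, ← hp, hik]
    · simp [leg2, hp]
  have hP2 : ∀ x y : Matrix (Fin n) (Fin n) (Yangian n),
      (leg1 n (Yangian n) y * (flipMatrix n (Yangian n) * leg2 n (Yangian n) x))
        (i, h) (j, k) = 0 := by
    intro x y
    rw [Matrix.mul_apply]
    refine Finset.sum_eq_zero fun p _ => ?_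
    rw [flipMatrix_mul]
    by_cases hp : h = p.2
    · simp [leg2, ← hp, hjh.symm]
    · simp [leg1, hp]
  induction r generalizing s with
  | zero =>
    rw [T_zero]
    split_ifs
    · exact Commute.one_left _
    · exact Commute.zero_left _
  | succ r ih =>
    have h2 := congrFun (congrFun (key r s) (i, h)) (j, k)
    simp only [PowerSeries.coeff_map, Matrix.add_apply, Matrix.sub_apply, leg1_mul_leg2,
      leg2_mul_leg1, hP1, hP2, add_zero] at h2
    simp only [Tneg, PowerSeries.coeff_mk, Matrix.of_apply, mul_smul_comm, smul_mul_assoc,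
      (ih (s + 1)).eq, sub_left_inj] at h2
    exact (smul_right_injective _ (by simp : (-1 : ℂ) ^ (r + 1) ≠ 0) h2).symm

/-! ### The weight filtration of the Yangian and leading terms of `omega` and `psi` -/

/-- The generator `T_{i,j}^{(r+1)}` indexed by `(i, j, r)`. -/
def gen (n : ℕ) (v : Fin n × Fin n × ℕ) : Yangian n := T n v.1 v.2.1 (v.2.2 + 1)

/-- The weight `2 r + 1` of `T_{i,j}^{(r+1)}`. For this choice the associated graded algebra is
the symmetric algebra of `𝔤𝔩_n[t]` with its linear Poisson bracket. -/
def wt {n : ℕ} (v : Fin n × Fin n × ℕ) : ℕ := 2 * v.2.2 + 1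

/-- The elements of weight less than `d`. -/
abbrev fil (n d : ℕ) : Submodule ℂ (Yangian n) := wordFiltration ℂ (gen n) wt d

theorem T_succ_mem_fil (n : ℕ) (i j : Fin n) (r : ℕ) : T n i j (r + 1) ∈ fil n (2 * r + 2) :=
  wordFiltration.letter_mem (K := ℂ) (g := gen n) (w := wt) (i, j, r)

theorem mem_fil_mul {n : ℕ} {x y : Yangian n} {a b c : ℕ} (hx : x ∈ fil n (a + 1))
    (hy : y ∈ fil n (b + 1)) (h : a + b < c) : x * y ∈ fil n c :=
  wordFiltration.mono (by omega) (wordFiltration.mul_mem hx hy)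

/-- Leading term of the commutator of generators. -/
theorem T_comm_sub_mem (n : ℕ) (i j h k : Fin n) (r s : ℕ) :
    T n i j (r + 1) * T n h k (s + 1) - T n h k (s + 1) * T n i j (r + 1)
      - ((if h = j then T n i k (r + s + 1) else 0) - (if i = k then T n h j (r + s + 1) else 0))
      ∈ fil n (2 * (r + s) + 1) := by
  induction r generalizing s with
  | zero =>
    have h1 := T_rel n i j h k 0 (s + 1)
    simp only [T_zero] at h1
    have h2 : T n i j (0 + 1) * T n h k (s + 1) - T n h k (s + 1) * T n i j (0 + 1)
      - ((if h = j then T n i k (0 + s + 1) else 0) - (if i = k then T n h j (0 + s + 1) else 0))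
      = 0 := by
      rw [zero_add 1, zero_add s]
      simp only [zero_add] at h1
      split_ifs at h1 ⊢ <;> simp_all [sub_eq_zero]
    rw [h2]
    exact zero_mem _
  | succ r ih =>
    have h1 := T_rel n i j h k (r + 1) (s + 1)
    have h2 := ih (s + 1)
    rw [show r + (s + 1) + 1 = r + 1 + s + 1 by omega] at h2
    have e : T n i j (r + 1 + 1) * T n h k (s + 1) - T n h k (s + 1) * T n i j (r + 1 + 1)
      - ((if h = j then T n i k (r + 1 + s + 1) else 0)
        - (if i = k then T n h j (r + 1 + s + 1) else 0))
      = (T n i j (r + 1) * T n h k (s + 1 + 1) - T n h k (s + 1 + 1) * T n i j (r + 1)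
      - ((if h = j then T n i k (r + 1 + s + 1) else 0)
        - (if i = k then T n h j (r + 1 + s + 1) else 0)))
      + (T n h j (r + 1) * T n i k (s + 1) - T n h j (s + 1) * T n i k (r + 1)) := by
      rw [← h1]; abel
    rw [e]
    -- The quadratic terms have weight `(2r+1) + (2s+1)`, one less than the linear term
    -- `T^{(r+s+2)}`. This is what the odd weights are for.
    refine add_mem (wordFiltration.mono (by omega) h2) (sub_mem ?_ ?_)
    · exact mem_fil_mul (T_succ_mem_fil n h j r) (T_succ_mem_fil n i k s) (by omega)
    · exact mem_fil_mul (T_succ_mem_fil n h j s) (T_succ_mem_fil n i k r) (by omega)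

theorem gen_comm_mem (n : ℕ) (v v' : Fin n × Fin n × ℕ) :
    gen n v * gen n v' - gen n v' * gen n v ∈ fil n (wt v + wt v') := by
  obtain ⟨i, j, r⟩ := v
  obtain ⟨h, k, s⟩ := v'
  have h1 := T_comm_sub_mem n i j h k r s
  have h2 : ∀ (c : Prop) [Decidable c] (a b : Fin n),
      (if c then T n a b (r + s + 1) else 0) ∈ fil n (2 * (r + s) + 2) := by
    intro c _ a b
    split_ifs
    · exact T_succ_mem_fil n a b (r + s)
    · exact zero_mem _
  have h3 := add_mem (wordFiltration.mono (Nat.le_succ _) h1)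
    (sub_mem (h2 (h = j) i k) (h2 (i = k) h j))
  rw [sub_add_cancel] at h3
  exact wordFiltration.mono (by simp only [wt]; omega) h3

theorem exists_mem_fil {n : ℕ} (x : Yangian n) : ∃ d, x ∈ fil n d := by
  obtain ⟨a, rfl⟩ := RingQuot.mkAlgHom_surjective ℂ (Rel n) x
  induction a using FreeAlgebra.induction with
  | grade0 c =>
    refine ⟨1, ?_⟩
    rw [AlgHom.commutes, Algebra.algebraMap_eq_smul_one]
    exact Submodule.smul_mem _ _ wordFiltration.one_mem
  | grade1 v => exact ⟨_, T_succ_mem_fil n v.1 v.2.1 v.2.2⟩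
  | mul a b ha hb =>
    obtain ⟨d, hd⟩ := ha
    obtain ⟨e, he⟩ := hb
    rw [map_mul]
    exact ⟨_, wordFiltration.mul_mem hd (wordFiltration.mono (Nat.le_succ _) he)⟩
  | add a b ha hb =>
    obtain ⟨d, hd⟩ := ha
    obtain ⟨e, he⟩ := hb
    rw [map_add]
    exact ⟨max d e, add_mem (wordFiltration.mono (le_max_left _ _) hd)
      (wordFiltration.mono (le_max_right _ _) he)⟩

/-- Solve `T(-u) T(-u)⁻¹ = 1` for the top coefficient: the linear term carries the sign
`-(-1)^(r+1)`, and the products of two lower coefficients have weight at most `2r`. -/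
theorem coeff_TnegInv_succ (n : ℕ) (i j : Fin n) (r : ℕ) :
    PowerSeries.coeff (r + 1) (TnegInv n) i j - (-1 : ℂ) ^ r • T n i j (r + 1)
      ∈ fil n (2 * r + 1) := by
  induction r using Nat.strong_induction_on generalizing i j with
  | _ r ih =>
  have hmem : ∀ s < r, ∀ i j, PowerSeries.coeff (s + 1) (TnegInv n) i j ∈ fil n (2 * s + 2) := by
    intro s hs i j
    rw [← sub_add_cancel (PowerSeries.coeff (s + 1) (TnegInv n) i j)
      ((-1 : ℂ) ^ s • T n i j (s + 1))]
    exact add_mem (wordFiltration.mono (Nat.le_succ _) (ih s hs i j))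
      (Submodule.smul_mem _ _ (T_succ_mem_fil n i j s))
  have h := congrArg (PowerSeries.coeff (r + 1)) (Tneg_mul_TnegInv n)
  rw [PowerSeries.coeff_mul, Finset.Nat.antidiagonal_succ, Finset.sum_cons, Finset.sum_map,
    Finset.Nat.sum_antidiagonal_eq_sum_range_succ_mk, Finset.sum_range_succ] at h
  have h' := congrFun (congrFun h i) j
  simp only [Function.Embedding.prodMap, Function.Embedding.coeFn_mk, Prod.map,
    Function.Embedding.refl_apply, Nat.succ_eq_add_one, Nat.sub_self, coeff_zero_TnegInv,
    PowerSeries.coeff_zero_eq_constantCoeff_apply (φ := Tneg n), constantCoeff_Tneg, one_mul,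
    mul_one, Matrix.add_apply, PowerSeries.coeff_one, Nat.add_eq_zero_iff, one_ne_zero, and_false,
    if_false, Matrix.zero_apply, Matrix.sum_apply] at h'
  have e : PowerSeries.coeff (r + 1) (TnegInv n) i j - (-1 : ℂ) ^ r • T n i j (r + 1)
      = -∑ x ∈ Finset.range r, (PowerSeries.coeff (x + 1) (Tneg n)
        * PowerSeries.coeff (r - x) (TnegInv n)) i j := by
    rw [eq_neg_iff_add_eq_zero, ← h']
    simp only [Tneg, PowerSeries.coeff_mk, Matrix.of_apply, pow_succ]
    module
  rw [e]
  refine neg_mem (sum_mem fun s hs => ?_)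
  rw [Finset.mem_range] at hs
  obtain ⟨t, ht⟩ : ∃ t, r - s = t + 1 := ⟨r - s - 1, by omega⟩
  rw [Matrix.mul_apply, ht]
  refine sum_mem fun k _ => ?_
  simp only [Tneg, PowerSeries.coeff_mk, Matrix.of_apply, smul_mul_assoc]
  exact Submodule.smul_mem _ _
    (mem_fil_mul (T_succ_mem_fil n i k s) (hmem t (by omega) k j) (by omega))

theorem omega_T (n : ℕ) (i j : Fin n) (r : ℕ) :
    omega n (T n i j r) = PowerSeries.coeff r (TnegInv n) i j := lift_T _ _ _ _ _ _

theorem omega_T_sub_mem (n : ℕ) (i j : Fin n) (r : ℕ) :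
    omega n (T n i j (r + 1)) - (-1 : ℂ) ^ r • T n i j (r + 1) ∈ fil n (2 * r + 1) := by
  rw [omega_T]
  exact coeff_TnegInv_succ n i j r

theorem omega_mem_fil {n d : ℕ} {x : Yangian n} (hx : x ∈ fil n d) : omega n x ∈ fil n d := by
  refine wordFiltration.map_mem (omega n) (fun v => ?_) hx
  have := add_mem (wordFiltration.mono (Nat.le_succ _) (omega_T_sub_mem n v.1 v.2.1 v.2.2))
    (Submodule.smul_mem _ ((-1 : ℂ) ^ v.2.2) (T_succ_mem_fil n v.1 v.2.1 v.2.2))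
  rwa [sub_add_cancel] at this

theorem relabel_mem_fil {k n d : ℕ} (f : Fin k ↪ Fin n) {x : Yangian k} (hx : x ∈ fil k d) :
    relabel f x ∈ fil n d := by
  refine wordFiltration.map_mem (relabel f) (fun v => ?_) hx
  rw [gen, relabel_T]
  exact T_succ_mem_fil n _ _ _

/-- The two applications of `omega` contribute the same sign `(-1)^r`, so on leading terms only the
index shift of `phi` remains. -/
theorem psi_T_sub_mem (m n : ℕ) (i j : Fin n) (r : ℕ) :
    psi m n (T n i j (r + 1)) - T (m + n) (Fin.natAdd m i) (Fin.natAdd m j) (r + 1)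
      ∈ fil (m + n) (2 * r + 1) := by
  have h1 := omega_mem_fil (relabel_mem_fil (Fin.natAddEmb m) (omega_T_sub_mem n i j r))
  rw [map_sub, map_sub, map_smul, map_smul, relabel_T] at h1
  have h2 := Submodule.smul_mem _ ((-1 : ℂ) ^ r)
    (omega_T_sub_mem (m + n) (Fin.natAdd m i) (Fin.natAdd m j) r)
  rw [smul_sub, smul_smul, ← mul_pow, neg_one_mul, neg_neg, one_pow, one_smul] at h2
  have h3 := add_mem h1 h2
  have e : (psi m n) (T n i j (r + 1))
      = omega (m + n) (relabel (Fin.natAddEmb m) (omega n (T n i j (r + 1)))) := rfl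
  rw [e]
  simpa only [Fin.natAddEmb_apply, sub_add_sub_cancel] using h3

theorem psi_mem_fil {m n d : ℕ} {x : Yangian n} (hx : x ∈ fil n d) :
    psi m n x ∈ fil (m + n) d :=
  omega_mem_fil (relabel_mem_fil _ (omega_mem_fil hx))

end Yangian

/-! ### Operators on polynomials with a leading multiplication symbol -/

section Symbols

open MvPolynomial

variable {κ : Type*} {w : κ → ℕ}

theorem weight_lt_of_mem_wordFiltration {f : MvPolynomial κ ℂ} {d : ℕ}
    (hf : f ∈ wordFiltration ℂ (X : κ → MvPolynomial κ ℂ) w d) (m : κ →₀ ℕ) (hm : coeff m f ≠ 0) :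
    Finsupp.weight w m < d := by
  classical
  induction hf using Submodule.span_induction with
  | zero => simp at hm
  | add x y _ _ hx hy =>
    by_cases h : coeff m x = 0
    · exact hy (by simpa [h] using hm)
    · exact hx h
  | smul c x _ hx => exact hx fun h => hm (by simp [h])
  | mem x hx =>
    obtain ⟨l, hl, rfl⟩ := hx
    rwa [isWeightedHomogeneous_list_prod_X (w := w) l hm]

theorem IsWeightedHomogeneous.eq_zero_of_mem {f : MvPolynomial κ ℂ} {d : ℕ}
    (hf : IsWeightedHomogeneous w f d) (h : f ∈ wordFiltration ℂ X w d) : f = 0 := by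
  ext m
  by_contra hm
  rw [coeff_zero] at hm
  exact (weight_lt_of_mem_wordFiltration h m hm).ne (hf hm)

theorem derivation_mem_wordFiltration (D : Derivation ℂ (MvPolynomial κ ℂ) (MvPolynomial κ ℂ))
    (hD : ∀ v, D (X v) ∈ wordFiltration ℂ X w (w v + 1)) {f : MvPolynomial κ ℂ} {d : ℕ}
    (hf : f ∈ wordFiltration ℂ X w d) : D f ∈ wordFiltration ℂ X w d := by
  induction hf using Submodule.span_induction with
  | zero => simp
  | add x y _ _ hx hy => rw [map_add]; exact add_mem hx hy
  | smul c x _ hx => rw [Derivation.map_smul]; exact Submodule.smul_mem _ _ hx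
  | mem x hx =>
    obtain ⟨l, hl, rfl⟩ := hx
    refine wordFiltration.mono (Nat.succ_le_of_lt hl) ?_
    clear hl
    induction l with
    | nil => simp
    | cons i l ih =>
      simp only [List.map_cons, List.prod_cons, List.sum_cons, Derivation.leibniz, smul_eq_mul]
      exact add_mem (wordFiltration.mono (by omega)
          (wordFiltration.mul_mem (wordFiltration.letter_mem i) ih))
        (wordFiltration.mono (by omega)
          (wordFiltration.mul_mem (wordFiltration.word_mem l (Nat.lt_succ_self _)) (hD i)))

/-- The operator `Φ` raises weights by at most `d`, and agrees with the multiplication by `s` up to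
terms of smaller weight. -/
structure HasSymbol (w : κ → ℕ) (Φ : Module.End ℂ (MvPolynomial κ ℂ)) (d : ℕ)
    (s : MvPolynomial κ ℂ) : Prop where
  symbol_mem : s ∈ wordFiltration ℂ X w (d + 1)
  sub_mem : ∀ e g, g ∈ wordFiltration ℂ X w (e + 1) → Φ g - s * g ∈ wordFiltration ℂ X w (d + e)

namespace HasSymbol

variable {Φ Ψ : Module.End ℂ (MvPolynomial κ ℂ)} {d e : ℕ} {s t : MvPolynomial κ ℂ}

theorem apply_mem (h : HasSymbol w Φ d s) {g : MvPolynomial κ ℂ}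
    (hg : g ∈ wordFiltration ℂ X w (e + 1)) : Φ g ∈ wordFiltration ℂ X w (d + e + 1) := by
  rw [← sub_add_cancel (Φ g) (s * g)]
  exact add_mem (wordFiltration.mono (Nat.le_succ _) (h.sub_mem e g hg))
    (wordFiltration.mono (by omega) (wordFiltration.mul_mem h.symbol_mem hg))

theorem zero : HasSymbol w (0 : Module.End ℂ (MvPolynomial κ ℂ)) d 0 :=
  ⟨zero_mem _, fun e g _ => by simp⟩

theorem add (h : HasSymbol w Φ d s) (h' : HasSymbol w Ψ d t) : HasSymbol w (Φ + Ψ) d (s + t) :=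
  ⟨add_mem h.symbol_mem h'.symbol_mem, fun e g hg => by
    rw [LinearMap.add_apply, add_mul, add_sub_add_comm]
    exact add_mem (h.sub_mem e g hg) (h'.sub_mem e g hg)⟩

theorem smul (c : ℂ) (h : HasSymbol w Φ d s) : HasSymbol w (c • Φ) d (c • s) :=
  ⟨Submodule.smul_mem _ _ h.symbol_mem, fun e g hg => by
    rw [LinearMap.smul_apply, smul_mul_assoc, ← smul_sub]
    exact Submodule.smul_mem _ _ (h.sub_mem e g hg)⟩

theorem sum {α : Type*} (F : Finset α) {Φ : α → Module.End ℂ (MvPolynomial κ ℂ)}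
    {s : α → MvPolynomial κ ℂ} (h : ∀ x ∈ F, HasSymbol w (Φ x) d (s x)) :
    HasSymbol w (∑ x ∈ F, Φ x) d (∑ x ∈ F, s x) := by
  classical
  induction F using Finset.induction_on with
  | empty => simpa using zero
  | insert a F ha ih =>
    rw [Finset.sum_insert ha, Finset.sum_insert ha]
    exact (h a (Finset.mem_insert_self _ _)).add
      (ih fun x hx => h x (Finset.mem_insert_of_mem hx))

theorem of_lt (h : HasSymbol w Φ d s) (hde : d < e) : HasSymbol w Φ e 0 :=
  ⟨zero_mem _, fun e' g hg => by
    rw [zero_mul, sub_zero]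
    exact wordFiltration.mono (by omega) (h.apply_mem hg)⟩

/-- Replace `Ψ` and then `Φ` by its multiplication; each replacement changes the result by smaller
weight only. -/
theorem mul (h : HasSymbol w Φ d s) (h' : HasSymbol w Ψ e t) :
    HasSymbol w (Φ * Ψ) (d + e) (s * t) := by
  refine ⟨wordFiltration.mono (by omega) (wordFiltration.mul_mem h.symbol_mem h'.symbol_mem),
    fun e' g hg => ?_⟩
  have e1 : (Φ * Ψ) g - s * t * g = (Φ (Ψ g) - s * Ψ g) + s * (Ψ g - t * g) := by
    rw [Module.End.mul_apply]
    ring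
  rw [e1]
  exact add_mem (wordFiltration.mono (by omega) (h.sub_mem _ _ (h'.apply_mem hg)))
    (wordFiltration.mono (by omega) (wordFiltration.mul_mem' h.symbol_mem (h'.sub_mem _ _ hg)))

theorem mulLeft (hs : s ∈ wordFiltration ℂ X w (d + 1)) :
    HasSymbol w (LinearMap.mulLeft ℂ s) d s :=
  ⟨hs, fun e g _ => by simp⟩

theorem one : HasSymbol w (1 : Module.End ℂ (MvPolynomial κ ℂ)) 0 1 :=
  ⟨wordFiltration.one_mem, fun e g _ => by simp⟩

theorem list_prod {α : Type*} {Φ : α → Module.End ℂ (MvPolynomial κ ℂ)}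
    {s : α → MvPolynomial κ ℂ} {u : α → ℕ} (h : ∀ x, HasSymbol w (Φ x) (u x) (s x)) (l : List α) :
    HasSymbol w (l.map Φ).prod (l.map u).sum (l.map s).prod := by
  induction l with
  | nil => simpa using one
  | cons x l ih =>
    simp only [List.map_cons, List.prod_cons, List.sum_cons]
    exact (h x).mul ih

end HasSymbol

end Symbols

/-! ### A polynomial representation from shifted evaluation homomorphisms -/

namespace Yangian

open MvPolynomial

/-- The variables `c_a` and `y^a_{i,j}` of the polynomial representation. -/
abbrev Var (n : ℕ) : Type := ℕ ⊕ (ℕ × Fin n × Fin n)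

/-- The weights of the variables: `c_a` has weight two and `y^a_{i,j}` has weight one. -/
def varWt {n : ℕ} : Var n → ℕ := Sum.elim (fun _ => 2) (fun _ => 1)

variable {n : ℕ}

/-- The derivation `∑_k y^a_{i,k} ∂ / ∂ y^a_{j,k}`. -/
def leftDerivation (a : ℕ) (i j : Fin n) :
    Derivation ℂ (MvPolynomial (Var n) ℂ) (MvPolynomial (Var n) ℂ) :=
  mkDerivation ℂ (Sum.elim (fun _ => 0)
    (fun v => if v.1 = a ∧ v.2.1 = j then X (Sum.inr (a, i, v.2.2)) else 0))

/-- The operators `y^a_{i,j} + ∑_k y^a_{i,k} ∂ / ∂ y^a_{j,k}`, which satisfy the relations of the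
matrix units of `𝔤𝔩_n`. -/
def unitOp (a : ℕ) (i j : Fin n) : Module.End ℂ (MvPolynomial (Var n) ℂ) :=
  LinearMap.mulLeft ℂ (X (Sum.inr (a, i, j)))
    + (leftDerivation a i j : MvPolynomial (Var n) ℂ →ₗ[ℂ] MvPolynomial (Var n) ℂ)

/-- The multiplication by `c_a`. -/
def shiftOp (n a : ℕ) : Module.End ℂ (MvPolynomial (Var n) ℂ) :=
  LinearMap.mulLeft ℂ (X (Sum.inl a))

theorem leftDerivation_X_inl (a b : ℕ) (i j : Fin n) :
    leftDerivation a i j (X (Sum.inl b)) = 0 := by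
  rw [leftDerivation, mkDerivation_X, Sum.elim_inl]

theorem leftDerivation_X_inr (a b : ℕ) (i j h k : Fin n) :
    leftDerivation a i j (X (Sum.inr (b, h, k)))
      = if b = a ∧ h = j then X (Sum.inr (a, i, k)) else 0 := by
  rw [leftDerivation, mkDerivation_X, Sum.elim_inr]

theorem lie_leftDerivation (a b : ℕ) (i j h k : Fin n) :
    ⁅leftDerivation a i j, leftDerivation b h k⁆
      = if a = b then (if h = j then leftDerivation a i k else 0)
          - (if i = k then leftDerivation a h j else 0) else 0 := by
  refine derivation_ext fun v => ?_
  rw [Derivation.commutator_apply]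
  rcases v with c | ⟨c, p, q⟩
  · simp only [leftDerivation_X_inl, map_zero, sub_zero]
    split_ifs <;> simp [leftDerivation_X_inl]
  · simp only [leftDerivation_X_inr, apply_ite (leftDerivation _ _ _), map_zero]
    by_cases hab : a = b
    · subst hab
      by_cases h1 : h = j <;> by_cases h2 : i = k <;>
        simp only [h1, h2, Derivation.sub_apply, Derivation.zero_apply, leftDerivation_X_inr,
          and_true, and_false, if_true, if_false, ite_self]
    · simp [hab, Ne.symm hab]

/-- The multiplications commute with each other and the derivations represent `𝔤𝔩_n`. The cross
terms are the derivations applied to the linear variables, and they reproduce the same bracket. The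
multiplication makes the symbol a free variable, the derivation being of lower weight. -/
theorem unitOp_comm (a b : ℕ) (i j h k : Fin n) :
    unitOp a i j * unitOp b h k - unitOp b h k * unitOp a i j
      = if a = b then (if h = j then unitOp a i k else 0) - (if i = k then unitOp a h j else 0)
        else 0 := by
  have hy : leftDerivation a i j (X (Sum.inr (b, h, k))) - leftDerivation b h k
        (X (Sum.inr (a, i, j)))
      = if a = b then (if h = j then X (Sum.inr (a, i, k)) else 0)
          - (if i = k then X (Sum.inr (a, h, j)) else 0) else 0 := by
    simp only [leftDerivation_X_inr]
    by_cases hab : a = b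
    · subst hab; simp
    · simp [hab, Ne.symm hab]
  refine LinearMap.ext fun g => ?_
  have e : (unitOp a i j * unitOp b h k - unitOp b h k * unitOp a i j) g
      = (leftDerivation a i j (X (Sum.inr (b, h, k))) - leftDerivation b h k
        (X (Sum.inr (a, i, j)))) * g + ⁅leftDerivation a i j, leftDerivation b h k⁆ g := by
    rw [Derivation.commutator_apply]
    simp only [unitOp, LinearMap.sub_apply, Module.End.mul_apply, LinearMap.add_apply,
      LinearMap.mulLeft_apply, Derivation.coeFn_coe, map_add, Derivation.leibniz, smul_eq_mul]
    ring
  rw [e, hy, lie_leftDerivation]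
  by_cases hab : a = b
  · by_cases h1 : h = j <;> by_cases h2 : i = k <;>
      simp only [hab, h1, h2, if_true, if_false, unitOp, LinearMap.sub_apply, LinearMap.add_apply,
        LinearMap.mulLeft_apply, Derivation.coeFn_coe, Derivation.sub_apply,
        Derivation.zero_apply, LinearMap.zero_apply] <;> ring
  · simp [hab]

theorem shiftOp_comm_unitOp (a b : ℕ) (i j : Fin n) : Commute (shiftOp n a) (unitOp b i j) := by
  refine LinearMap.ext fun g => ?_
  simp only [shiftOp, unitOp, Module.End.mul_apply, LinearMap.add_apply,
      LinearMap.mulLeft_apply, Derivation.coeFn_coe, Derivation.leibniz, smul_eq_mul,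
      leftDerivation_X_inl]
  ring

theorem shiftOp_comm_shiftOp (a b : ℕ) : Commute (shiftOp n a) (shiftOp n b) := by
  refine LinearMap.ext fun g => ?_
  simp only [shiftOp, Module.End.mul_apply, LinearMap.mulLeft_apply]
  ring

/-- The coefficients of `1 + E (u - c)⁻¹`. -/
def shiftedEval {A : Type*} [Ring A] (c : A) (E : Fin n → Fin n → A) (i j : Fin n) : ℕ → A
  | 0 => if i = j then 1 else 0
  | r + 1 => c ^ r * E i j

theorem isRTT_shiftedEval {A : Type*} [Ring A] {c : A} {E : Fin n → Fin n → A}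
    (hcE : ∀ i j, Commute c (E i j))
    (hE : ∀ i j h k, E i j * E h k - E h k * E i j
      = (if h = j then E i k else 0) - (if i = k then E h j else 0)) :
    IsRTT (shiftedEval c E) := by
  refine ⟨fun i j => rfl, fun i j h k r s => ?_⟩
  have hc : ∀ (r s : ℕ) (i j h k : Fin n),
      c ^ r * E i j * (c ^ s * E h k) = c ^ (r + s) * (E i j * E h k) := by
    intro r s i j h k
    rw [mul_assoc, ← mul_assoc (E i j), ← ((hcE i j).pow_left s).eq, pow_add]
    simp only [mul_assoc]
  rcases r with _ | r <;> rcases s with _ | s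
  · simp only [shiftedEval]
    split_ifs <;> simp
  · have e : c ^ 0 * E i j * (c ^ s * E h k) - c ^ s * E h k * (c ^ 0 * E i j)
        = c ^ s * ((if h = j then E i k else 0) - (if i = k then E h j else 0)) := by
      rw [hc, hc, ← hE, zero_add, add_zero, mul_sub]
    simp only [shiftedEval]
    rw [e]
    split_ifs <;> simp [mul_sub]
  · have e : c ^ r * E i j * (c ^ 0 * E h k) - c ^ 0 * E h k * (c ^ r * E i j)
        = c ^ r * ((if h = j then E i k else 0) - (if i = k then E h j else 0)) := by
      rw [hc, hc, ← hE, zero_add, add_zero, mul_sub]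
    simp only [shiftedEval]
    rw [e]
    split_ifs <;> simp [mul_sub]
  · simp only [shiftedEval, hc]
    rw [show r + 1 + s = r + (s + 1) by omega, show s + (r + 1) = r + (s + 1) by omega,
      show s + 1 + r = r + (s + 1) by omega, add_comm s r]
    simp

/-- The coefficients of `1 + E^a (u - c_a)⁻¹`. -/
abbrev evalFamily (a : ℕ) : Fin n → Fin n → ℕ → Module.End ℂ (MvPolynomial (Var n) ℂ) :=
  shiftedEval (shiftOp n a) (unitOp a)

theorem evalFamily_comm_of_ne {a b : ℕ} (hab : a ≠ b) (i j h k : Fin n) (r s : ℕ) :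
    Commute (evalFamily a i j r) (evalFamily b h k s) := by
  have h0 : ∀ (x : Module.End ℂ (MvPolynomial (Var n) ℂ)) (c : Prop) [Decidable c],
      Commute (if c then 1 else 0) x := by
    intro x c _
    split_ifs
    · exact Commute.one_left _
    · exact Commute.zero_left _
  rcases r with _ | r
  · exact h0 _ _
  rcases s with _ | s
  · exact (h0 _ _).symm
  have h1 : Commute (unitOp a i j) (unitOp b h k) := by
    have := unitOp_comm a b i j h k
    rwa [if_neg hab, sub_eq_zero] at this
  exact (((shiftOp_comm_shiftOp a b).pow_pow r s).mul_right
    ((shiftOp_comm_unitOp a b h k).pow_left r)).mul_left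
    ((((shiftOp_comm_unitOp b a i j).symm).pow_right s).mul_right h1)

theorem isRTT_evalFamily (a : ℕ) : IsRTT (evalFamily (n := n) a) :=
  isRTT_shiftedEval (shiftOp_comm_unitOp a a) fun i j h k => by simpa using unitOp_comm a a i j h k

/-- The coefficients of `∏_{a < N} (1 + E^a (u - c_a)⁻¹)`. -/
def prodFamily : ℕ → Fin n → Fin n → ℕ → Module.End ℂ (MvPolynomial (Var n) ℂ)
  | 0 => fun i j r => if r = 0 then (if i = j then 1 else 0) else 0
  | N + 1 => mulFamily (prodFamily N) (evalFamily N)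

theorem prodFamily_commute (N : ℕ) (x : Module.End ℂ (MvPolynomial (Var n) ℂ))
    (hx : ∀ a < N, ∀ i j r, Commute (evalFamily a i j r) x) (i j : Fin n) (r : ℕ) :
    Commute (prodFamily N i j r) x := by
  induction N generalizing i j r with
  | zero =>
    simp only [prodFamily]
    split_ifs
    · exact Commute.one_left _
    · exact Commute.zero_left _
    · exact Commute.zero_left _
  | succ N ih =>
    refine Commute.sum_left _ _ _ fun p _ => Commute.sum_left _ _ _ fun k _ => ?_
    exact (ih (fun a ha => hx a (by omega)) _ _ _).mul_left (hx N (Nat.lt_succ_self _) _ _ _)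

theorem isRTT_prodFamily (N : ℕ) : IsRTT (prodFamily (n := n) N) := by
  induction N with
  | zero =>
    refine ⟨fun i j => rfl, fun i j h k r s => ?_⟩
    rcases r with _ | r <;> rcases s with _ | s <;> simp [prodFamily]
  | succ N ih =>
    refine ih.mulFamily (isRTT_evalFamily N) fun i j h k r s => ?_
    exact prodFamily_commute N _ (fun a ha _ _ _ => evalFamily_comm_of_ne ha.ne _ _ _ _ _ _) _ _ _

theorem hasSymbol_evalFamily (a : ℕ) (i j : Fin n) (r : ℕ) :
    HasSymbol varWt (evalFamily a i j (r + 1)) (2 * r + 1)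
      (X (Sum.inl a) ^ r * X (Sum.inr (a, i, j))) := by
  have h1 : HasSymbol varWt (shiftOp n a) 2 (X (Sum.inl a)) :=
    HasSymbol.mulLeft (wordFiltration.letter_mem (w := varWt) (Sum.inl a : Var n))
  have h2 : HasSymbol varWt (shiftOp n a ^ r) (2 * r) (X (Sum.inl a) ^ r) := by
    induction r with
    | zero => simpa using HasSymbol.one
    | succ r ih => rw [pow_succ, pow_succ]; exact ih.mul h1
  have h3 : HasSymbol varWt (unitOp a i j) 1 (X (Sum.inr (a, i, j))) := by
    refine ⟨wordFiltration.letter_mem (w := varWt) (Sum.inr (a, i, j) : Var n), fun e g hg => ?_⟩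
    rw [unitOp, LinearMap.add_apply, LinearMap.mulLeft_apply, add_sub_cancel_left,
      Derivation.coeFn_coe, add_comm]
    refine derivation_mem_wordFiltration _ (fun v => ?_) hg
    rcases v with c | ⟨c, p, q⟩
    · simp [leftDerivation]
    · simp only [leftDerivation, mkDerivation_X, Sum.elim_inr]
      split_ifs
      · exact wordFiltration.letter_mem (w := varWt) (Sum.inr (a, i, q) : Var n)
      · exact zero_mem _
  exact h2.mul h3

/-- The symbol `∑_{a < N} c_a^r y^a_{i,j}` of `T_{i,j}^{(r+1)}`. -/
def genSymbol (N : ℕ) (v : Fin n × Fin n × ℕ) : MvPolynomial (Var n) ℂ :=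
  ∑ a ∈ Finset.range N, X (Sum.inl a) ^ v.2.2 * X (Sum.inr (a, v.1, v.2.1))

/-- Only the terms linear in the evaluation factors are leading: a product of coefficients `p + 1`
and `r - p` has weight `2r`, below `2r + 1`. The symbols of the factors therefore add. -/
theorem hasSymbol_prodFamily (N : ℕ) (i j : Fin n) (r : ℕ) :
    HasSymbol varWt (prodFamily N i j (r + 1)) (2 * r + 1) (genSymbol N (i, j, r)) := by
  induction N generalizing i j r with
  | zero => simpa [prodFamily, genSymbol] using HasSymbol.zero
  | succ N ih =>
    have e : prodFamily (N + 1) i j (r + 1) = evalFamily N i j (r + 1) + (prodFamily N i j (r + 1)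
        + ∑ p ∈ Finset.range r, ∑ k, prodFamily N i k (p + 1) * evalFamily N k j (r - p)) := by
      simp only [prodFamily, mulFamily]
      rw [Finset.Nat.antidiagonal_succ, Finset.sum_cons, Finset.sum_map,
        Finset.Nat.sum_antidiagonal_eq_sum_range_succ_mk, Finset.sum_range_succ]
      simp only [Function.Embedding.prodMap, Function.Embedding.coeFn_mk, Prod.map,
        Function.Embedding.refl_apply, Nat.succ_eq_add_one, Nat.sub_self, shiftedEval,
        (isRTT_prodFamily N).zero, ite_mul, one_mul, zero_mul, mul_ite, mul_one, mul_zero,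
        Finset.sum_ite_eq, Finset.sum_ite_eq', Finset.mem_univ, if_true]
      abel
    have hs : genSymbol (N + 1) (i, j, r)
        = X (Sum.inl N) ^ r * X (Sum.inr (N, i, j)) + (genSymbol N (i, j, r) + 0) := by
      rw [genSymbol, Finset.sum_range_succ, add_zero, add_comm]
      rfl
    rw [e, hs]
    refine (hasSymbol_evalFamily N i j r).add ((ih i j r).add ?_)
    have : (0 : MvPolynomial (Var n) ℂ) = ∑ p ∈ Finset.range r, ∑ k : Fin n, 0 := by simp
    rw [this]
    refine HasSymbol.sum _ fun p hp => HasSymbol.sum _ fun k _ => ?_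
    rw [Finset.mem_range] at hp
    obtain ⟨q, hq⟩ : ∃ q, r - p = q + 1 := ⟨r - p - 1, by omega⟩
    rw [hq]
    exact ((ih i k p).mul (hasSymbol_evalFamily N k j q)).of_lt (by omega)

/-- The representation of the Yangian on polynomials with `T(u)` acting as
`∏_{a < N} (1 + E^a (u - c_a)⁻¹)`. -/
def polyRep (n N : ℕ) : Yangian n →ₐ[ℂ] Module.End ℂ (MvPolynomial (Var n) ℂ) :=
  lift (prodFamily N) (isRTT_prodFamily N).zero (isRTT_prodFamily N).rel

theorem hasSymbol_polyRep_gen (N : ℕ) (v : Fin n × Fin n × ℕ) :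
    HasSymbol varWt (polyRep n N (gen n v)) (wt v) (genSymbol N v) := by
  rw [polyRep, gen, lift_T]
  exact hasSymbol_prodFamily N v.1 v.2.1 v.2.2

theorem isWeightedHomogeneous_genSymbol (N : ℕ) (v : Fin n × Fin n × ℕ) :
    IsWeightedHomogeneous varWt (genSymbol N v) (wt v) := by
  refine IsWeightedHomogeneous.sum _ _ _ fun a _ => ?_
  have := ((isWeightedHomogeneous_X ℂ varWt (Sum.inl a : Var n)).pow v.2.2).mul
    (isWeightedHomogeneous_X ℂ varWt (Sum.inr (a, v.1, v.2.1) : Var n))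
  convert this using 1
  simp [wt, varWt, mul_comm]

/-! ### Independence of ordered monomials (Poincaré–Birkhoff–Witt) -/

/-- Polynomials in the symbols vanish only if they are zero. -/
theorem eq_zero_of_aeval_genSymbol {f : MvPolynomial (Fin n × Fin n × ℕ) ℂ} {N : ℕ}
    (hN : ∀ v ∈ f.vars, v.2.2 < N) (hf : aeval (genSymbol N) f = 0) : f = 0 := by
  have hV : IsUnit (Matrix.vandermonde fun a : Fin N => ((a : ℕ) : ℂ)).det := by
    rw [isUnit_iff_ne_zero, Matrix.det_vandermonde_ne_zero_iff]
    intro a b hab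
    exact Fin.ext (Nat.cast_injective (R := ℂ) hab)
  set V := Matrix.vandermonde fun a : Fin N => ((a : ℕ) : ℂ)
  have hVV : V⁻¹ * V = 1 := Matrix.nonsing_inv_mul _ hV
  -- A left inverse to the substitution of symbols: put `c_a = a` and let `y^a_{i,j}` be the
  -- combination of the `X (i, j, s)` given by the inverse Vandermonde matrix, so that `∑_a a^r
  -- y^a_{i,j}` becomes `X (i, j, r)` for `r < N`.
  let q : Var n → MvPolynomial (Fin n × Fin n × ℕ) ℂ := Sum.elim (fun a : ℕ => C (a : ℂ))
    (fun v => if h : v.1 < N then ∑ s : Fin N, C (V⁻¹ s ⟨v.1, h⟩) * X (v.2.1, v.2.2, (s : ℕ))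
      else 0)
  have hq : ∀ v ∈ f.vars, aeval q (genSymbol N v) = X v := by
    rintro ⟨i, j, r⟩ hv
    have hr : r < N := hN _ hv
    rw [genSymbol, map_sum, Finset.sum_range]
    have e : ∀ a : Fin N, aeval q (X (Sum.inl (a : ℕ)) ^ r
          * X (Sum.inr ((a : ℕ), i, j)) : MvPolynomial (Var n) ℂ)
        = ∑ s : Fin N, C (V⁻¹ s a * V a ⟨r, hr⟩) * X (i, j, (s : ℕ)) := by
      intro a
      rw [map_mul, map_pow, aeval_X, aeval_X]
      simp only [q, Sum.elim_inl, Sum.elim_inr, a.isLt, dif_pos, Fin.eta]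
      rw [Finset.mul_sum]
      refine Finset.sum_congr rfl fun s _ => ?_
      simp only [V, Matrix.vandermonde_apply, map_mul, map_pow]
      ring
    simp only [e]
    rw [Finset.sum_comm]
    simp only [← Finset.sum_mul, ← map_sum, ← Matrix.mul_apply, hVV, Matrix.one_apply]
    rw [Finset.sum_eq_single ⟨r, hr⟩]
    · simp
    · intro b _ hb
      simp [hb]
    · simp
  have h2 : aeval q (aeval (genSymbol N) f) = f := by
    have h3 : aeval q (aeval (genSymbol N) f) = aeval (fun v => aeval q (genSymbol N v)) f := by
      rw [← AlgHom.comp_apply, comp_aeval]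
    have h4 : aeval (fun v => aeval q (genSymbol N v)) f = aeval X f :=
      eval₂Hom_congr' rfl (fun v hv _ => hq v hv) rfl
    rw [h3, h4, aeval_X_left_apply]
  rw [← h2, hf, map_zero]

/-- The ordered monomials in the generators are linearly independent, also modulo terms of smaller
weight. -/
theorem eq_zero_of_orderedLift_mem {f : MvPolynomial (Fin n × Fin n × ℕ) ℂ} {d : ℕ}
    (hf : IsWeightedHomogeneous wt f d) (h : orderedLift ℂ (gen n) f ∈ fil n d) : f = 0 := by
  obtain ⟨N, hN⟩ : ∃ N, ∀ v ∈ f.vars, v.2.2 < N :=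
    ⟨f.vars.sup (fun v => v.2.2) + 1, fun v hv =>
      Nat.lt_succ_of_le (Finset.le_sup (f := fun v : Fin n × Fin n × ℕ => v.2.2) hv)⟩
  have hmem : ∀ x ∈ fil n d, polyRep n N x 1 ∈ wordFiltration ℂ X varWt d := by
    intro x hx
    induction hx using Submodule.span_induction with
    | zero => simp
    | add x y _ _ hx hy => rw [map_add, LinearMap.add_apply]; exact add_mem hx hy
    | smul c x _ hx => rw [map_smul, LinearMap.smul_apply]; exact Submodule.smul_mem _ _ hx
    | mem x hx =>
      obtain ⟨l, hl, rfl⟩ := hx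
      have := HasSymbol.list_prod (hasSymbol_polyRep_gen N) l
      rw [map_list_prod, List.map_map]
      exact wordFiltration.mono (by omega) (this.apply_mem (e := 0) wordFiltration.one_mem)
  have hprod : ∀ m : Fin n × Fin n × ℕ →₀ ℕ, ((Finsupp.toMultiset m).toList.map (genSymbol N)).prod
      = aeval (genSymbol N) (monomial m (1 : ℂ)) := by
    intro m
    rw [← Multiset.prod_coe, ← Multiset.map_coe, Multiset.coe_toList, Finsupp.toMultiset_map,
      Finsupp.prod_toMultiset, aeval_monomial, map_one, one_mul]
    exact Finsupp.prod_mapDomain_index (fun _ => pow_zero _) (fun _ _ _ => pow_add _ _ _)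
  have hsym : HasSymbol varWt (polyRep n N (orderedLift ℂ (gen n) f)) d
      (aeval (genSymbol N) f) := by
    have e : aeval (genSymbol N) f = ∑ m ∈ f.support,
        coeff m f • aeval (genSymbol N) (monomial m (1 : ℂ)) := by
      conv_lhs => rw [f.as_sum]
      rw [map_sum]
      refine Finset.sum_congr rfl fun m _ => ?_
      rw [← map_smul, smul_monomial, smul_eq_mul, mul_one]
    rw [e]
    conv in orderedLift ℂ (gen n) f => rw [f.as_sum]
    rw [map_sum, map_sum]
    refine HasSymbol.sum _ fun m hm => ?_
    rw [orderedLift_monomial, map_smul]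
    refine HasSymbol.smul _ ?_
    have := HasSymbol.list_prod (hasSymbol_polyRep_gen N) (Finsupp.toMultiset m).toList
    rwa [sum_map_toList_toMultiset, hf (mem_support_iff.mp hm), hprod,
      ← Function.comp_def, ← List.map_map, ← map_list_prod] at this
  have hhom : IsWeightedHomogeneous varWt (aeval (genSymbol N) f) d := by
    rw [aeval_def, eval₂_eq]
    refine IsWeightedHomogeneous.sum _ _ _ fun m hm => ?_
    rw [algebraMap_eq]
    refine IsWeightedHomogeneous.C_mul ?_ _
    have := IsWeightedHomogeneous.prod m.support (fun v => genSymbol N v ^ m v)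
      (fun v => m v • wt v) fun v _ => (isWeightedHomogeneous_genSymbol N v).pow (m v)
    rw [← hf (mem_support_iff.mp hm), Finsupp.weight_apply]
    exact this
  -- Applied to the polynomial `1`, the operator of the ordered lift gives `aeval (genSymbol N) f`
  -- up to weight below `d`, and is itself of weight below `d` by assumption. The homogeneous
  -- polynomial `aeval (genSymbol N) f` of degree `d` must vanish.
  have h1 := hsym.sub_mem 0 1 wordFiltration.one_mem
  rw [mul_one, add_zero] at h1
  have h2 := sub_mem (hmem _ h) h1
  rw [sub_sub_cancel] at h2
  exact eq_zero_of_aeval_genSymbol hN (IsWeightedHomogeneous.eq_zero_of_mem hhom h2)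

theorem orderedLift_gen_X (v : Fin n × Fin n × ℕ) : orderedLift ℂ (gen n) (X v) = gen n v := by
  rw [X, orderedLift_monomial, one_smul, Finsupp.toMultiset_single, one_smul,
    Multiset.toList_singleton, List.map_singleton, List.prod_singleton]

/-! ### The centralizer of commuting elements with diagonal leading terms -/

/-- The Poisson bracket of `t_{i,i}^{(r+1)}` with the generators of the symmetric algebra. -/
def diagBracket (i : Fin n) (r : ℕ) (v : Fin n × Fin n × ℕ) : MvPolynomial (Fin n × Fin n × ℕ) ℂ :=
  (if v.1 = i then X (i, v.2.1, r + v.2.2) else 0)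
    - (if i = v.2.1 then X (v.1, i, r + v.2.2) else 0)

theorem isWeightedHomogeneous_diagBracket (i : Fin n) (r : ℕ) (v : Fin n × Fin n × ℕ) :
    IsWeightedHomogeneous wt (diagBracket i r v) (2 * r + wt v) := by
  have h : ∀ (c : Prop) [Decidable c] (a b : Fin n), IsWeightedHomogeneous wt
      (if c then X (a, b, r + v.2.2) else 0 : MvPolynomial (Fin n × Fin n × ℕ) ℂ)
        (2 * r + wt v) := by
    intro c _ a b
    split_ifs
    · convert isWeightedHomogeneous_X ℂ wt (a, b, r + v.2.2) using 1
      simp only [wt]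
      omega
    · exact isWeightedHomogeneous_zero _ _ _
  exact (h _ _ _).sub (h _ _ _)

theorem comm_gen_sub_diagBracket_mem {x : Yangian n} {i : Fin n} {r : ℕ}
    (hx : x - T n i i (r + 1) ∈ fil n (2 * r + 1)) (v : Fin n × Fin n × ℕ) :
    x * gen n v - gen n v * x - orderedLift ℂ (gen n) (diagBracket i r v)
      ∈ fil n (2 * r + wt v) := by
  obtain ⟨h, k, s⟩ := v
  have h1 := T_comm_sub_mem n i i h k r s
  have h2 := wordFiltration.comm_mem (gen_comm_mem n) hx
    (wordFiltration.letter_mem (K := ℂ) (g := gen n) (w := wt) (h, k, s))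
  have h3 : orderedLift ℂ (gen n) (diagBracket i r (h, k, s))
      = (if h = i then T n i k (r + s + 1) else 0)
        - (if i = k then T n h i (r + s + 1) else 0) := by
    simp only [diagBracket, map_sub, apply_ite (orderedLift ℂ (gen n)), map_zero,
      orderedLift_gen_X, gen]
  rw [h3]
  have e : x * gen n (h, k, s) - gen n (h, k, s) * x
      - ((if h = i then T n i k (r + s + 1) else 0) - (if i = k then T n h i (r + s + 1) else 0))
      = ((x - T n i i (r + 1)) * gen n (h, k, s) - gen n (h, k, s) * (x - T n i i (r + 1)))
        + (T n i i (r + 1) * T n h k (s + 1) - T n h k (s + 1) * T n i i (r + 1)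
      - ((if h = i then T n i k (r + s + 1) else 0)
        - (if i = k then T n h i (r + s + 1) else 0))) := by
    simp only [gen, sub_mul, mul_sub]
    abel
  rw [e]
  exact add_mem h2 (wordFiltration.mono (by simp only [wt]; omega) h1)

/-- A polynomial Poisson commuting with all `t_{i,i}^{(r)}` only involves diagonal variables. -/
theorem diag_of_bracket_eq_zero {f : MvPolynomial (Fin n × Fin n × ℕ) ℂ}
    (hf : ∀ i r, mkDerivation ℂ (diagBracket i r) f = 0) {m : Fin n × Fin n × ℕ →₀ ℕ}
    (hm : m ∈ f.support) {v : Fin n × Fin n × ℕ} (hv : v ∈ m.support) : v.1 = v.2.1 := by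
  obtain ⟨h, k, s⟩ := v
  by_contra hhk
  change h ≠ k at hhk
  obtain ⟨r, hr⟩ : ∃ r, ∀ v ∈ f.vars, v.2.2 < r :=
    ⟨f.vars.sup (fun v => v.2.2) + 1, fun v hv =>
      Nat.lt_succ_of_le (Finset.le_sup (f := fun v : Fin n × Fin n × ℕ => v.2.2) hv)⟩
  -- The bracket with `t_{h,h}^{(r+1)}` carries the variable `(h, k, s)` to `(h, k, r + s)`; its
  -- other term never meets `(h, k, r + s)` because `h ≠ k`. As `r` exceeds every degree occurring
  -- in `f`, both summands of the commutator kill `f`.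
  have hlie : ⁅pderiv (R := ℂ) (h, k, r + s), mkDerivation ℂ (diagBracket h r)⁆
      = pderiv (h, k, s) := by
    refine derivation_ext fun v => ?_
    obtain ⟨a, b, c⟩ := v
    rw [Derivation.commutator_apply, mkDerivation_X]
    have h1 : mkDerivation ℂ (diagBracket h r) (pderiv (R := ℂ) (h, k, r + s) (X (a, b, c)))
        = 0 := by
      rw [pderiv_X, Pi.single_apply]
      split_ifs <;> simp
    have h2 : pderiv (R := ℂ) (h, k, r + s) (if h = b then X (a, h, r + c) else 0) = 0 := by
      split_ifs
      · exact pderiv_X_of_ne (by simp [hhk])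
      · simp
    rw [h1, sub_zero, diagBracket, map_sub, h2, sub_zero]
    by_cases ha : a = h
    · by_cases hbc : b = k ∧ c = s
      · obtain ⟨rfl, rfl⟩ := hbc
        subst ha
        simp
      · rw [if_pos ha, pderiv_X_of_ne, pderiv_X_of_ne]
        · simpa [ha] using hbc
        · simpa using hbc
    · rw [if_neg ha, map_zero, pderiv_X_of_ne]
      simp [ha]
  have h1 : pderiv (R := ℂ) (h, k, r + s) f = 0 := by
    refine pderiv_eq_zero_of_notMem_vars fun hmem => ?_
    have := hr _ hmem
    simp only at this
    omega
  have h2 : pderiv (h, k, s) f = 0 := by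
    rw [← hlie, Derivation.commutator_apply, hf, h1, map_zero, map_zero, sub_zero]
  -- In characteristic zero this coefficient of the derivative is the coefficient of `m` in `f`
  -- times a nonzero integer.
  have h3 := congrArg (coeff (m - Finsupp.single (h, k, s) 1)) h2
  have h4 : Finsupp.single (h, k, s) 1 ≤ m := by
    rw [Finsupp.single_le_iff]
    exact Nat.one_le_iff_ne_zero.mpr (Finsupp.mem_support_iff.mp hv)
  rw [coeff_pderiv, tsub_add_cancel_of_le h4, coeff_zero] at h3
  rcases mul_eq_zero.mp h3 with h5 | h5
  · exact mem_support_iff.mp hm h5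
  · exact Nat.cast_add_one_ne_zero _ h5

/-- Commuting elements `D_i^{(r)}` with the same leading terms as the `T_{i,i}^{(r+1)}` generate
their own centralizer. -/
theorem mem_adjoin_of_commute {D : Fin n → ℕ → Yangian n}
    (hD : ∀ i r, D i r - T n i i (r + 1) ∈ fil n (2 * r + 1))
    (hDD : ∀ i j r s, Commute (D i r) (D j s)) {z : Yangian n}
    (hz : ∀ i r, Commute (D i r) z) :
    z ∈ Algebra.adjoin ℂ (Set.range fun p : Fin n × ℕ => D p.1 p.2) := by
  obtain ⟨d, hd⟩ := exists_mem_fil z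
  induction d generalizing z with
  | zero =>
    rw [wordFiltration.eq_zero_of_mem_zero hd]
    exact zero_mem _
  | succ d ih =>
    obtain ⟨f, hf, hzf⟩ := exists_symbol (gen_comm_mem n) hd
    have hbr : ∀ i r, mkDerivation ℂ (diagBracket i r) f = 0 := by
      intro i r
      obtain ⟨h1, h2⟩ := comm_orderedLift_sub_mem (gen_comm_mem n)
        (isWeightedHomogeneous_diagBracket i r) (comm_gen_sub_diagBracket_mem (hD i r)) hf
      refine eq_zero_of_orderedLift_mem h1 ?_
      have h3 : D i r * (z - orderedLift ℂ (gen n) f) - (z - orderedLift ℂ (gen n) f) * D i r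
          ∈ fil n (2 * r + d) := by
        -- `comm_mem` needs a bound of the form `d + 1`; for `d = 0` the lower order part of `z` is
        -- zero.
        rcases d with _ | d
        · simp [wordFiltration.eq_zero_of_mem_zero hzf]
        · have hDr : D i r ∈ fil n (2 * r + 1 + 1) := by
            rw [← sub_add_cancel (D i r) (T n i i (r + 1))]
            exact add_mem (wordFiltration.mono (Nat.le_succ _) (hD i r)) (T_succ_mem_fil n i i r)
          exact wordFiltration.mono (by omega)
            (wordFiltration.comm_mem (gen_comm_mem n) hDr hzf)
      have h4 := neg_mem (add_mem h3 h2)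
      have e : -(D i r * (z - orderedLift ℂ (gen n) f) - (z - orderedLift ℂ (gen n) f) * D i r
          + (D i r * orderedLift ℂ (gen n) f - orderedLift ℂ (gen n) f * D i r
            - orderedLift ℂ (gen n) (mkDerivation ℂ (diagBracket i r) f)))
          = orderedLift ℂ (gen n) (mkDerivation ℂ (diagBracket i r) f) := by
        have h5 := (hz i r).eq
        rw [mul_sub, sub_mul, h5]
        abel
      rwa [e] at h4
    -- The substitution that turns the symbol into an element of the subalgebra. The off-diagonal
    -- values never occur in the lift of `f`; they are chosen so that every letter keeps its leading
    -- term.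
    let g : Fin n × Fin n × ℕ → Yangian n := fun v =>
      if v.1 = v.2.1 then D v.1 v.2.2 else gen n v
    have hg : ∀ v, gen n v - g v ∈ fil n (wt v) := by
      rintro ⟨i, j, r⟩
      by_cases hij : i = j
      · subst hij
        simp only [g, if_true]
        rw [← neg_sub]
        exact neg_mem (hD i r)
      · simp [g, hij]
    have hmem : orderedLift ℂ g f
        ∈ Algebra.adjoin ℂ (Set.range fun p : Fin n × ℕ => D p.1 p.2) := by
      rw [f.as_sum, map_sum]
      refine sum_mem fun m hm => ?_
      rw [orderedLift_monomial]
      refine Subalgebra.smul_mem _ (list_prod_mem fun x hx => ?_) _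
      obtain ⟨v, hv, rfl⟩ := List.mem_map.mp hx
      rw [Multiset.mem_toList, Finsupp.mem_toMultiset] at hv
      have hvd := diag_of_bracket_eq_zero hbr hm hv
      simp only [g, if_pos hvd]
      exact Algebra.subset_adjoin ⟨(v.1, v.2.2), rfl⟩
    have hsub : z - orderedLift ℂ g f ∈ fil n d := by
      rw [← sub_add_sub_cancel z (orderedLift ℂ (gen n) f)]
      exact add_mem hzf (orderedLift_sub_orderedLift_mem hg hf)
    have hcomm : ∀ i r, Commute (D i r) (orderedLift ℂ g f) := by
      intro i r
      have : Algebra.adjoin ℂ (Set.range fun p : Fin n × ℕ => D p.1 p.2)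
          ≤ Subalgebra.centralizer ℂ {D i r} := by
        refine Algebra.adjoin_le ?_
        rintro _ ⟨p, rfl⟩
        rw [SetLike.mem_coe, Subalgebra.mem_centralizer_iff]
        rintro _ rfl
        exact hDD _ _ _ _
      exact (Subalgebra.mem_centralizer_iff ℂ).mp (this hmem) _ rfl
    have := ih (fun i r => (hz i r).sub_right (hcomm i r)) hsub
    rw [← sub_add_cancel z (orderedLift ℂ g f)]
    exact add_mem this hmem

/-! ### Commutation of the blocks -/

theorem eq_top_of_T_mem (S : Subalgebra ℂ (Yangian n)) (h : ∀ i j r, T n i j r ∈ S) : S = ⊤ := by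
  refine Algebra.eq_top_iff.mpr fun x => ?_
  obtain ⟨a, rfl⟩ := RingQuot.mkAlgHom_surjective ℂ (Rel n) x
  induction a using FreeAlgebra.induction with
  | grade0 c => rw [AlgHom.commutes]; exact S.algebraMap_mem c
  | grade1 v => exact h v.1 v.2.1 (v.2.2 + 1)
  | mul a b ha hb => rw [map_mul]; exact mul_mem ha hb
  | add a b ha hb => rw [map_add]; exact add_mem ha hb

theorem algHom_ext_T {A : Type*} [Ring A] [Algebra ℂ A] {f g : Yangian n →ₐ[ℂ] A}
    (h : ∀ i j r, f (T n i j r) = g (T n i j r)) : f = g := by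
  have := eq_top_of_T_mem (AlgHom.equalizer f g) h
  exact AlgHom.ext fun x => (this ▸ Algebra.mem_top : x ∈ AlgHom.equalizer f g)

/-- Two homomorphisms out of Yangians have commuting images if the images of the generators
commute. -/
theorem commute_of_commute_T {k l : ℕ} {A : Type*} [Ring A] [Algebra ℂ A]
    {f : Yangian k →ₐ[ℂ] A} {g : Yangian l →ₐ[ℂ] A}
    (h : ∀ i j r i' j' r', Commute (f (T k i j r)) (g (T l i' j' r'))) (x : Yangian k)
    (y : Yangian l) : Commute (f x) (g y) := by
  have h1 : ∀ i j r, Commute (f (T k i j r)) (g y) := by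
    intro i j r
    have := eq_top_of_T_mem ((Subalgebra.centralizer ℂ {f (T k i j r)}).comap g) (by
      intro i' j' r'
      rw [Subalgebra.mem_comap, Subalgebra.mem_centralizer_iff]
      rintro _ rfl
      exact h _ _ _ _ _ _)
    have hy : y ∈ (Subalgebra.centralizer ℂ {f (T k i j r)}).comap g := this ▸ Algebra.mem_top
    exact (Subalgebra.mem_centralizer_iff ℂ).mp hy _ rfl
  have := eq_top_of_T_mem ((Subalgebra.centralizer ℂ {g y}).comap f) (by
    intro i j r
    rw [Subalgebra.mem_comap, Subalgebra.mem_centralizer_iff]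
    rintro _ rfl
    exact (h1 i j r).symm)
  have hx : x ∈ (Subalgebra.centralizer ℂ {g y}).comap f := this ▸ Algebra.mem_top
  exact ((Subalgebra.mem_centralizer_iff ℂ).mp hx _ rfl).symm

theorem standardEmbedding_T {k : ℕ} (h : k ≤ n) (i j : Fin k) (r : ℕ) :
    standardEmbedding h (T k i j r) = T n (Fin.castLE h i) (Fin.castLE h j) r :=
  relabel_T _ _ _ _

theorem standardEmbedding_standardEmbedding {k l : ℕ} (h : k ≤ l) (h' : l ≤ n) (x : Yangian k) :
    standardEmbedding h' (standardEmbedding h x) = standardEmbedding (h.trans h') x := by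
  have : (standardEmbedding h').comp (standardEmbedding h) = standardEmbedding (h.trans h') := by
    refine algHom_ext_T fun i j r => ?_
    simp [standardEmbedding_T]
  exact DFunLike.congr_fun this x

/-- The image of `psi k l` lies in the algebra generated by the entries of `T(-u)⁻¹` with both
indices in the last `l` places, while the first factor only involves `T_{i,j}` with both indices
among the first `k`: the case of `coeff_TnegInv_commute`. -/
theorem commute_standardEmbedding_psi {k l : ℕ} (hk : k ≤ n) (hl : k + l ≤ n) (x : Yangian k)
    (y : Yangian l) : Commute (standardEmbedding hk x) (standardEmbedding hl (psi k l y)) := by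
  rw [← standardEmbedding_standardEmbedding (Nat.le_add_right k l) hl x]
  refine Commute.map ?_ (standardEmbedding hl)
  have e : psi k l y = ((omega (k + l)).comp (phi k l)) (omega l y) := rfl
  rw [e]
  refine commute_of_commute_T (fun i j r i' j' r' => ?_) x (omega l y)
  rw [AlgHom.comp_apply, phi, relabel_T, standardEmbedding_T, omega_T]
  refine coeff_TnegInv_commute ?_ ?_ r r'
  all_goals
    intro h
    have := congrArg Fin.val h
    simp at this
    omega

/-- For `n = 1` the right-hand side of the relation is itself a commutator of lower index, so
induction on `r` works. -/
theorem commute_of_one (x y : Yangian 1) : Commute x y := by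
  have key : ∀ r s, Commute (T 1 0 0 r) (T 1 0 0 s) := by
    intro r
    induction r with
    | zero => intro s; simp [T_zero]
    | succ r ih =>
      intro s
      have h1 := T_rel 1 0 0 0 0 r s
      rw [(ih (s + 1)).eq, (ih s).eq, sub_self, sub_self, sub_zero] at h1
      exact sub_eq_zero.mp h1
  refine commute_of_commute_T (f := AlgHom.id ℂ _) (g := AlgHom.id ℂ _)
    (fun i j r i' j' r' => ?_) x y
  rw [Subsingleton.elim i 0, Subsingleton.elim j 0, Subsingleton.elim i' 0, Subsingleton.elim j' 0]
  exact key r r'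

/-! ### The diagonal elements of the Levi subalgebra -/

theorem relabel_sub_T_mem {k : ℕ} (f : Fin k ↪ Fin n) {x : Yangian k} {i : Fin k} {r : ℕ}
    (hx : x - T k i i (r + 1) ∈ fil k (2 * r + 1)) :
    relabel f x - T n (f i) (f i) (r + 1) ∈ fil n (2 * r + 1) := by
  have := relabel_mem_fil f hx
  rwa [map_sub, relabel_T] at this

theorem psi_sub_T_mem {m k : ℕ} {x : Yangian k} {i : Fin k} {r : ℕ}
    (hx : x - T k i i (r + 1) ∈ fil k (2 * r + 1)) :
    psi m k x - T (m + k) (Fin.natAdd m i) (Fin.natAdd m i) (r + 1)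
      ∈ fil (m + k) (2 * r + 1) := by
  have := add_mem (psi_mem_fil (m := m) hx) (psi_T_sub_mem m k i i r)
  rwa [map_sub, sub_add_sub_cancel] at this

variable {m : ℕ}

/-- The element `D_k^{(r+1)}` of the block `a`. -/
def blockDiag (ν : Fin m → ℕ) (hν : ∑ a, ν a = n) (a : Fin m) (k : Fin (ν a)) (r : ℕ) :
    Yangian n :=
  blockMap ν hν a (standardEmbedding k.isLt (psi k 1 (T 1 0 0 (r + 1))))

theorem blockDiag_mem_levi (ν : Fin m → ℕ) (hν : ∑ a, ν a = n) (a : Fin m) (k : Fin (ν a)) (r : ℕ) :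
    blockDiag ν hν a k r ∈ levi ν hν :=
  (le_iSup (fun a => (blockMap ν hν a).range) a) ⟨_, rfl⟩

theorem blockDiag_sub_T_mem (ν : Fin m → ℕ) (hν : ∑ a, ν a = n) (a : Fin m) (k : Fin (ν a)) (r : ℕ)
    (i : Fin n) (hi : (i : ℕ) = ∑ b ∈ Finset.Iio a, ν b + k) :
    blockDiag ν hν a k r - T n i i (r + 1) ∈ fil n (2 * r + 1) := by
  have h0 : T 1 0 0 (r + 1) - T 1 0 0 (r + 1) ∈ fil 1 (2 * r + 1) := by simp
  have h1 := relabel_sub_T_mem (Fin.castLEEmb k.isLt) (psi_sub_T_mem (m := k) h0)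
  have hle : ∑ b ∈ Finset.Iio a, ν b + ν a ≤ n := by
    rw [← hν, add_comm, ← Finset.sum_insert (f := ν) (Finset.notMem_Iio_self (b := a))]
    exact Finset.sum_le_univ_sum_of_nonneg fun _ => Nat.zero_le _
  have h2 := relabel_sub_T_mem (Fin.castLEEmb hle)
    (psi_sub_T_mem (m := ∑ b ∈ Finset.Iio a, ν b) h1)
  have hi' : i = Fin.castLEEmb hle (Fin.natAdd (∑ b ∈ Finset.Iio a, ν b)
      (Fin.castLEEmb k.isLt (Fin.natAdd (k : ℕ) (0 : Fin 1)))) := Fin.ext (by simp [hi])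
  rw [← hi'] at h2
  exact h2

theorem sum_Iio_add_le (ν : Fin m → ℕ) {a b : Fin m} (hab : a < b) :
    ∑ c ∈ Finset.Iio a, ν c + ν a ≤ ∑ c ∈ Finset.Iio b, ν c := by
  rw [add_comm, ← Finset.sum_insert (f := ν) (Finset.notMem_Iio_self (b := a))]
  refine Finset.sum_le_sum_of_subset fun c hc => ?_
  rw [Finset.mem_insert, Finset.mem_Iio] at hc
  rw [Finset.mem_Iio]
  rcases hc with rfl | hc
  · exact hab
  · exact hc.trans hab

/-- The earlier block lies in the standard `Y_k`, where `k` is the offset of the later block, and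
the later block is an image of `psi k`. -/
theorem blockMap_commute_of_lt (ν : Fin m → ℕ) (hν : ∑ a, ν a = n) {a b : Fin m} (hab : a < b)
    (x : Yangian (ν a)) (y : Yangian (ν b)) :
    Commute (blockMap ν hν a x) (blockMap ν hν b y) := by
  simp only [blockMap, AlgHom.comp_apply]
  generalize_proofs h1 h2
  rw [← standardEmbedding_standardEmbedding (sum_Iio_add_le ν hab)
    ((Nat.le_add_right _ _).trans h2)]
  exact commute_standardEmbedding_psi _ _ _ _

theorem blockDiag_commute_of_lt (ν : Fin m → ℕ) (hν : ∑ a, ν a = n) (a : Fin m)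
    {k l : Fin (ν a)} (hkl : k < l) (r s : ℕ) :
    Commute (blockDiag ν hν a k r) (blockDiag ν hν a l s) := by
  refine Commute.map ?_ (blockMap ν hν a)
  rw [← standardEmbedding_standardEmbedding (Nat.succ_le_of_lt hkl) l.isLt.le]
  exact commute_standardEmbedding_psi (k := (l : ℕ)) (l := 1) _ l.isLt _ _

theorem blockDiag_commute (ν : Fin m → ℕ) (hν : ∑ a, ν a = n) (a b : Fin m) (k : Fin (ν a))
    (l : Fin (ν b)) (r s : ℕ) : Commute (blockDiag ν hν a k r) (blockDiag ν hν b l s) := by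
  rcases lt_trichotomy a b with hab | rfl | hab
  · exact blockMap_commute_of_lt ν hν hab _ _
  · rcases lt_trichotomy k l with hkl | rfl | hkl
    · exact blockDiag_commute_of_lt ν hν a hkl r s
    · exact (((commute_of_one _ _).map (psi k 1)).map (standardEmbedding k.isLt)).map
        (blockMap ν hν a)
    · exact (blockDiag_commute_of_lt ν hν a hkl s r).symm
  · exact (blockMap_commute_of_lt ν hν hab _ _).symm

/-- The block containing `i` is found as the least one whose partial sum of `ν` exceeds `i`; empty
blocks are skipped automatically. -/
theorem exists_block (ν : Fin m → ℕ) (hν : ∑ a, ν a = n) (i : Fin n) :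
    ∃ (a : Fin m) (k : Fin (ν a)), (i : ℕ) = ∑ b ∈ Finset.Iio a, ν b + k := by
  classical
  have hex : ∃ j : ℕ, (i : ℕ) < ∑ b ∈ Finset.univ.filter (fun b : Fin m => (b : ℕ) < j), ν b := by
    refine ⟨m, ?_⟩
    rw [Finset.filter_true_of_mem fun b _ => b.isLt, hν]
    exact i.isLt
  obtain ⟨j, hj⟩ : ∃ j, Nat.find hex = j + 1 := by
    refine Nat.exists_eq_succ_of_ne_zero fun h0 => ?_
    have := Nat.find_spec hex
    rw [h0] at this
    simp at this
  have h1 := Nat.find_spec hex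
  have h2 := Nat.find_min hex (m := j) (by omega)
  rw [hj] at h1
  have hjm : j < m := by
    by_contra hjm
    apply h2
    rw [Finset.filter_true_of_mem fun b _ => by have := b.isLt; omega, hν]
    exact i.isLt
  have e1 : Finset.univ.filter (fun b : Fin m => (b : ℕ) < j) = Finset.Iio ⟨j, hjm⟩ := by
    ext b
    simp [Fin.lt_def]
  have e2 : Finset.univ.filter (fun b : Fin m => (b : ℕ) < j + 1)
      = insert ⟨j, hjm⟩ (Finset.Iio ⟨j, hjm⟩) := by
    ext b
    simp only [Finset.mem_filter, Finset.mem_univ, true_and, Finset.mem_insert, Finset.mem_Iio,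
      Fin.lt_def, Fin.ext_iff]
    omega
  rw [e1, not_lt] at h2
  rw [e2, Finset.sum_insert Finset.notMem_Iio_self] at h1
  refine ⟨⟨j, hjm⟩, ⟨(i : ℕ) - ∑ b ∈ Finset.Iio ⟨j, hjm⟩, ν b, by omega⟩, ?_⟩
  simp only
  omega

/-- The `blockDiag` elements lie in `levi`, so whatever centralizes `levi` commutes with them and
belongs to the algebra they generate, which is again inside `levi`. -/
theorem centralizer_levi_le (ν : Fin m → ℕ) (hν : ∑ a, ν a = n) :
    Subalgebra.centralizer ℂ (levi ν hν : Set (Yangian n)) ≤ levi ν hν := by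
  intro z hz
  rw [Subalgebra.mem_centralizer_iff] at hz
  choose a k hi using exists_block ν hν
  have hmem := mem_adjoin_of_commute (D := fun i r => blockDiag ν hν (a i) (k i) r)
    (fun i r => blockDiag_sub_T_mem ν hν (a i) (k i) r i (hi i))
    (fun i j r s => blockDiag_commute ν hν _ _ _ _ _ _) (z := z)
    (fun i r => hz _ (blockDiag_mem_levi ν hν _ _ _))
  refine Algebra.adjoin_le ?_ hmem
  rintro _ ⟨p, rfl⟩
  exact blockDiag_mem_levi ν hν _ _ _

end Yangian
end

theorem corollary7p4 {m n : ℕ} (ν : Fin m → ℕ) (hν : ∑ a, ν a = n) :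
    Subalgebra.centralizer ℂ (Yangian.levi ν hν : Set (Yangian n)) =
      (Subalgebra.center ℂ (Yangian.levi ν hν)).map (Yangian.levi ν hν).val := by
  ext z
  rw [Subalgebra.mem_map]
  constructor
  · intro hz
    refine ⟨⟨z, Yangian.centralizer_levi_le ν hν hz⟩, ?_, rfl⟩
    rw [Subalgebra.mem_center_iff]
    intro y
    exact Subtype.ext ((Subalgebra.mem_centralizer_iff ℂ).mp hz y y.2)
  · rintro ⟨x, hx, rfl⟩
    rw [Subalgebra.mem_centralizer_iff]
    intro y hy
    exact congrArg Subtype.val ((Subalgebra.mem_center_iff.mp hx) ⟨y, hy⟩)
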